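/- Let $\lambda:\mathbb R\to(0,\infty)$ be continuous with $\int_{-\infty}^0\lambda(x)\,dx=\int_0^\infty\lambda(x)\,dx=\infty$. Let $\mathcal P_\lambda$ be the law of the Poisson point process on $\mathbb R$ with intensity $\lambda(x)\,dx$, regarded as a measure on locally finite sequences $\dots<z_{-1}<z_0<z_1<\dots$ (arrival moments) numbered so that $z_0$ is the smallest positive point. Let $\mathcal T$ be the law of a stationary ergodic sequence $(\eta_i)_{i\in\mathbb Z}$ of positive service times, let $\mathcal S=\mathcal P_\lambda\times\mathcal T$, and write $\omega=(z_i,\eta_i)_{i\in\mathbb Z}$. For $t\in\mathbb R$ let $\theta_t(x)$ be the unique point with $\int_x^{\theta_t(x)}\lambda(u)\,du=t$, and let $\theta_t\omega$ be the configuration obtained from $\omega$ by moving each $z_i$ to $\theta_t(z_i)$ with its service time $\eta_i$, renumbered so that the smallest positive arrival moment has index $0$. Let $\tilde\Omega$ be the set of configurations which violate at most finitely many of the inequalities $\eta_{-k}+\dots+\eta_{-1}+z_{-k}<0$, $k\ge1$. Assume the no-overload condition $\mathcal S\bigl(\bigcap_{t\in\mathbb R}\theta_t\tilde\Omega\bigr)=1$.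 For a configuration $\omega$ let $I(\omega)$ be the set of indices $i$ with $z_i\ge z_{i-k}+\eta_{i-k}$ for all $k>0$. Define $R\omega=(Rz_j,\eta_j)_j$ by $Rz_j=z_j$ if $j\in I(\omega)$, and otherwise $Rz_j=z_i+\eta_i+\dots+\eta_{j-1}$, where $i$ is the largest element of $I(\omega)$ smaller than $j$. Call $z_i$ a head of a cluster (the beginning of a busy period) if $R^nz_i=z_i$ for all $n\ge0$. For $x\in\mathbb R$ define $V_x(\omega)=\dfrac1{\lambda(z_i)\,\eta_j}$ if $$z_i+\eta_i+\dots+\eta_{j-1}<x<z_i+\eta_i+\dots+\eta_j$$ for some head $z_i$ and some $j\ge i$ such that none of $z_{i+1},\dots,z_j$ is a head, i.e. if customer $j$ of the busy period started by $z_i$ is in service at $x$ (almost surely the pair $(i,j)$ is then unique). Put $V_x(\omega)=0$ otherwise. Then for every $x\in\mathbb R$ the function $V_x$ is $\mathcal S$-integrable and $$\mathbb E\,V_x=\int V_x\,d\mathcal S=1.$$ -/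

import Mathlib

open MeasureTheory ProbabilityTheory Filter

noncomputable section

namespace QueueFlow

/-- A configuration `ω = (…, (z_{-1}, η_{-1}), (z_0, η_0), (z_1, η_1), …)`:
the first component lists the arrival moments, the second one the service times. -/
abbrev Config : Type := (ℤ → ℝ) × (ℤ → ℝ)

/-- The measure `λ(x) dx` on the line. -/
def rateMeasure (rate : ℝ → ℝ) : Measure ℝ :=
  volume.withDensity fun x => ENNReal.ofReal (rate x)

/-- Number of points of the sequence `z` in the set `B`. -/
def pointCount (B : Set ℝ) (z : ℤ → ℝ) : ℕ := {i : ℤ | z i ∈ B}.ncard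

/-- `P` is the law, on increasing doubly infinite sequences numbered so that `z 0` is the smallest
positive point, of the Poisson point process with intensity measure `m`. -/
structure IsPoissonProcess (m : Measure ℝ) (P : Measure (ℤ → ℝ)) : Prop where
  isProbabilityMeasure : IsProbabilityMeasure P
  config : ∀ᵐ z ∂P, StrictMono z ∧ Tendsto z atTop atTop ∧ Tendsto z atBot atBot ∧
    z (-1) ≤ 0 ∧ 0 < z 0
  map_pointCount : ∀ B : Set ℝ, MeasurableSet B → Bornology.IsBounded B →
    P.map (pointCount B) = poissonMeasure (m B).toNNReal
  indep : ∀ (n : ℕ) (B : Fin n → Set ℝ), (∀ k, MeasurableSet (B k)) →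
    (∀ k, Bornology.IsBounded (B k)) → Pairwise (fun k l => Disjoint (B k) (B l)) →
    iIndepFun (fun k z => pointCount (B k) z) P

/-- The left shift of a sequence of service times. -/
def seqShift (η : ℤ → ℝ) : ℤ → ℝ := fun i => η (i + 1)

/-- `T` is the law of a stationary ergodic sequence of positive service times. -/
structure IsServiceProcess (T : Measure (ℤ → ℝ)) : Prop where
  isProbabilityMeasure : IsProbabilityMeasure T
  ergodic : Ergodic seqShift T
  pos : ∀ᵐ η ∂T, ∀ i, 0 < η i

/-- The nonlinear shift of the line: `pointFlow rate t x` is the point `y` with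
`∫ u in x..y, rate u = t`. -/
def pointFlow (rate : ℝ → ℝ) (t x : ℝ) : ℝ :=
  Function.invFun (fun y : ℝ => ∫ u in x..y, rate u) t

/-- The index of the smallest positive point of `z`. -/
def firstPos (z : ℤ → ℝ) : ℤ := sInf {i : ℤ | 0 < z i}

/-- The nonlinear shift `θ_t` of configurations: every arrival moment is moved by the flow and keeps
its service time; the customers are renumbered so that the one with index `0` is again the one with
the smallest positive arrival moment. -/
def configFlow (rate : ℝ → ℝ) (t : ℝ) (ω : Config) : Config :=
  (fun i => pointFlow rate t (ω.1 (i + firstPos fun k => pointFlow rate t (ω.1 k))),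
   fun i => ω.2 (i + firstPos fun k => pointFlow rate t (ω.1 k)))

/-- The configurations that violate only finitely many of the inequalities
`η_{-k} + ⋯ + η_{-1} + z_{-k} < 0`, `k ≥ 1`. -/
def stableConfigs : Set Config :=
  {ω | {k : ℕ | 1 ≤ k ∧ ¬ (∑ i ∈ Finset.Ico (-(k : ℤ)) 0, ω.2 i + ω.1 (-(k : ℤ)) < 0)}.Finite}

/-- The no-overload condition for a law `S` of configurations: the intersection over all real `t`
of the sets `θ_t stableConfigs` has full measure (the image under `θ_t` is the preimage under
`θ_{-t}`, and `-t` runs over all reals with `t`). -/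
def NoOverload (rate : ℝ → ℝ) (S : Measure Config) : Prop :=
  ∀ᵐ ω ∂S, ω ∈ ⋂ t : ℝ, configFlow rate t ⁻¹' stableConfigs

/-- The set of indices of the customers that are in no conflict with an earlier one. -/
def noConflict (ω : Config) : Set ℤ :=
  {i | ∀ k : ℤ, 0 < k → ω.1 (i - k) + ω.2 (i - k) ≤ ω.1 i}

/-- The index of the last customer before `j` that is in no conflict with an earlier one. -/
def lastNoConflict (ω : Config) (j : ℤ) : ℤ := sSup {i | i < j ∧ i ∈ noConflict ω}

open Classical in
/-- One step `R` of the resolution of conflicts (Lindley equation): customers without conflict stay,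
any other one starts service when all the customers from the preceding conflict-free one on have
been served one after another. -/
def resolve (ω : Config) : Config :=
  (fun j => if j ∈ noConflict ω then ω.1 j
    else ω.1 (lastNoConflict ω j) + ∑ i ∈ Finset.Ico (lastNoConflict ω j) j, ω.2 i,
   ω.2)

/-- Customer `i` is the head of a cluster (the beginning of a busy period). -/
def IsHead (ω : Config) (i : ℤ) : Prop := ∀ n : ℕ, (resolve^[n] ω).1 i = ω.1 i

/-- Customer `j` belongs to the cluster whose head is customer `i`, and is in service at `x`:
`z_i + η_i + ⋯ + η_{j-1} < x < z_i + η_i + ⋯ + η_j`. -/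
def InServiceAt (ω : Config) (x : ℝ) (i j : ℤ) : Prop :=
  IsHead ω i ∧ i ≤ j ∧ (∀ k, i < k → k ≤ j → ¬ IsHead ω k) ∧
    ω.1 i + ∑ l ∈ Finset.Ico i j, ω.2 l < x ∧ x < ω.1 i + ∑ l ∈ Finset.Icc i j, ω.2 l

open Classical in
/-- `V_x(ω) = 1 / (λ(z) η_j)`, where `z` is the head of the busy period that contains `x` and `η_j`
the service time of the customer in service at `x`; and `V_x(ω) = 0` if there is none. -/
def V (rate : ℝ → ℝ) (x : ℝ) (ω : Config) : ℝ :=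
  if h : ∃ p : ℤ × ℤ, InServiceAt ω x p.1 p.2 then
    1 / (rate (ω.1 h.choose.1) * ω.2 h.choose.2)
  else 0

end QueueFlow

end

noncomputable section

namespace QueueFlow

/-! Put Q_i = `cumService η i` and call z_i - Q_i the excess of customer i. Resolving conflicts
never lowers an excess, never moves a weak record of the excess (a value at least as large as all
earlier ones), and eventually lifts every other customer. So heads are exactly the records
(`Recurrent.isHead_iff`), provided records occur arbitrarily far in the past. This holds almost
surely because the excess tends to -∞ at -∞ (`ae_tendsto_excess`), which is what the no-overload
condition gives.

Almost surely V_x is therefore a sum over pairs (i, n) of a nonnegative function of the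
configuration seen from customer i, with at most one nonzero term: i is a head and its n-th follower
is in service at x (`Recurrent.V_eq`). Stationarity of the service times lets the term of index i be
computed with service times not depending on i. Mecke's formula (`IsPoissonProcess.mecke`) then
turns the sum over i into an integral over the arrival moment y of the head with density λ(y), which
cancels the factor 1/λ(y) in V_x.

A second use of stationarity, now by -n, makes the customer in service have service time η_0 for
every n, and y = s + Q_{-n} makes s the moment its service starts, so that s runs over (x - η_0, x).
There remains, for fixed s, the sum over n of the probability that a customer arriving at s + Q_{-n}
is a head whose next n customers all wait. With M_k the number of arrivals in (s + Q_{-k}, s) minus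
k, this event says that n is the last maximum of M. Since M_0 = 0 and M_k < 0 eventually, exactly
one n qualifies, and the probabilities sum to 1 (`tsum_busyProb`). The expectation is then the mean
of η_0 · (1/η_0) = 1. -/

/-! ### Partial sums of service times -/

/-- The sum of `η` from `0` to `i`, with sign for negative `i`. -/
def cumService (η : ℤ → ℝ) (i : ℤ) : ℝ :=
  ∑ k ∈ Finset.Ico 0 i, η k - ∑ k ∈ Finset.Ico i 0, η k

lemma cumService_zero (η : ℤ → ℝ) : cumService η 0 = 0 := by simp [cumService]

lemma cumService_add_one (η : ℤ → ℝ) (i : ℤ) :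
    cumService η (i + 1) = cumService η i + η i := by
  unfold cumService
  rcases le_or_gt 0 i with h | h
  · rw [Finset.Ico_eq_empty_of_le (show (0 : ℤ) ≤ i + 1 by lia),
      Finset.Ico_eq_empty_of_le h, ← Finset.insert_Ico_right_eq_Ico_add_one h,
      Finset.sum_insert (by simp)]
    simp [add_comm]
  · rw [Finset.Ico_eq_empty_of_le h.le, Finset.Ico_eq_empty_of_le (show i + 1 ≤ 0 by lia),
      ← Finset.insert_Ico_add_one_left_eq_Ico h, Finset.sum_insert (by simp)]
    simp

lemma sum_Ico_eq_cumService (η : ℤ → ℝ) {a b : ℤ} (h : a ≤ b) :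
    ∑ k ∈ Finset.Ico a b, η k = cumService η b - cumService η a := by
  induction b, h using Int.leInduction with
  | base => simp
  | succ b h ih =>
    rw [← Finset.insert_Ico_right_eq_Ico_add_one h, Finset.sum_insert (by simp), ih,
      cumService_add_one]
    ring

lemma sum_Icc_eq_cumService (η : ℤ → ℝ) {a b : ℤ} (h : a ≤ b) :
    ∑ k ∈ Finset.Icc a b, η k = cumService η (b + 1) - cumService η a := by
  rw [← sum_Ico_eq_cumService η (by lia : a ≤ b + 1)]
  congr 1

lemma cumService_strictMono {η : ℤ → ℝ} (h : ∀ i, 0 < η i) : StrictMono (cumService η) :=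
  strictMono_int_of_lt_succ fun i => by
    have := h i
    rw [cumService_add_one]
    linarith

/-- The sequence seen from its `i`-th term. -/
def shiftBy (i : ℤ) (w : ℤ → ℝ) : ℤ → ℝ := fun k => w (k + i)

lemma cumService_shiftBy (η : ℤ → ℝ) (i k : ℤ) :
    cumService (shiftBy i η) k = cumService η (k + i) - cumService η i := by
  induction k using Int.induction_on with
  | zero => simp [cumService_zero]
  | succ k ih =>
    rw [cumService_add_one, ih, add_right_comm, cumService_add_one]
    simp only [shiftBy]
    ring
  | pred k ih =>
    have h1 := cumService_add_one (shiftBy i η) (-(k : ℤ) - 1)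
    have h2 := cumService_add_one η (-(k : ℤ) - 1 + i)
    rw [sub_add_cancel, ih] at h1
    rw [show -(k : ℤ) - 1 + i + 1 = -(k : ℤ) + i by ring] at h2
    simp only [shiftBy] at h1
    linarith

/-! ### Heads of clusters as records -/

/-- The arrival moment of a customer relative to the cumulated service times. -/
def excess (ω : Config) (i : ℤ) : ℝ := ω.1 i - cumService ω.2 i

/-- The customer `i` finds the server idle. -/
def FindsIdle (ω : Config) (i : ℤ) : Prop := ∀ l, l < i → excess ω l ≤ excess ω i

lemma mem_noConflict_iff {ω : Config} {i : ℤ} :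
    i ∈ noConflict ω ↔ ∀ l, l < i → ω.1 l + ω.2 l ≤ ω.1 i := by
  refine ⟨fun h l hl => ?_, fun h k hk => h _ (by lia)⟩
  simpa using h (i - l) (by lia)

lemma lastNoConflict_spec {ω : Config} {j : ℤ} (h : ∃ i < j, i ∈ noConflict ω) :
    lastNoConflict ω j < j ∧ lastNoConflict ω j ∈ noConflict ω ∧
      ∀ i < j, i ∈ noConflict ω → i ≤ lastNoConflict ω j := by
  have hb : BddAbove {i | i < j ∧ i ∈ noConflict ω} := ⟨j, fun i hi => hi.1.le⟩
  have := Int.csSup_mem (s := {i | i < j ∧ i ∈ noConflict ω}) h hb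
  exact ⟨this.1, this.2, fun i hi hi' => le_csSup hb ⟨hi, hi'⟩⟩

/-- Service times are positive and customers finding the server idle occur arbitrarily far in the
past. -/
def Recurrent (ω : Config) : Prop := (∀ i, 0 < ω.2 i) ∧ ∀ j, ∃ i < j, FindsIdle ω i

lemma FindsIdle.mem_noConflict {ω : Config} (hη : ∀ i, 0 < ω.2 i) {i : ℤ} (h : FindsIdle ω i) :
    i ∈ noConflict ω := by
  refine mem_noConflict_iff.2 fun l hl => ?_
  have h1 := h l hl
  have h2 := (cumService_strictMono hη).monotone (show l + 1 ≤ i by lia)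
  rw [cumService_add_one] at h2
  simp only [excess] at h1
  linarith

lemma Recurrent.last_spec {ω : Config} (h : Recurrent ω) (j : ℤ) :
    lastNoConflict ω j < j ∧ lastNoConflict ω j ∈ noConflict ω ∧
      ∀ i < j, i ∈ noConflict ω → i ≤ lastNoConflict ω j :=
  lastNoConflict_spec <| (h.2 j).imp fun _ hi => ⟨hi.1, hi.2.mem_noConflict h.1⟩

lemma resolve_of_mem {ω : Config} {j : ℤ} (h : j ∈ noConflict ω) :
    (resolve ω).1 j = ω.1 j := by simp [resolve, h]

lemma excess_resolve_of_mem {ω : Config} {j : ℤ} (h : j ∈ noConflict ω) :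
    excess (resolve ω) j = excess ω j := by simp [excess, resolve, h]

lemma Recurrent.excess_resolve {ω : Config} (hω : Recurrent ω) {j : ℤ} (h : j ∉ noConflict ω) :
    excess (resolve ω) j = excess ω (lastNoConflict ω j) := by
  simp only [excess, resolve, h, if_false]
  rw [sum_Ico_eq_cumService _ (hω.last_spec j).1.le]
  ring

lemma FindsIdle.resolve {ω : Config} (hω : Recurrent ω) {i : ℤ} (h : FindsIdle ω i) :
    FindsIdle (resolve ω) i := by
  intro l hl
  rw [excess_resolve_of_mem (h.mem_noConflict hω.1)]
  by_cases hl' : l ∈ noConflict ω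
  · rw [excess_resolve_of_mem hl']; exact h l hl
  · rw [hω.excess_resolve hl']; exact h _ ((hω.last_spec l).1.trans hl)

lemma Recurrent.resolve {ω : Config} (hω : Recurrent ω) : Recurrent (resolve ω) :=
  ⟨hω.1, fun j => (hω.2 j).imp fun _ hi => ⟨hi.1, hi.2.resolve hω⟩⟩

lemma Recurrent.iterate {ω : Config} (hω : Recurrent ω) (n : ℕ) :
    Recurrent (QueueFlow.resolve^[n] ω) := by
  induction n with
  | zero => exact hω
  | succ n ih => rw [Function.iterate_succ_apply']; exact ih.resolve

/-- A customer in conflict is moved strictly later. Follow a conflict back from j to some l: either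
l is at or before the last conflict-free customer, where the bound is direct, or l is itself in
conflict and has the same last conflict-free customer at a smaller distance. No monotonicity of the
arrival moments is needed, so the lemma also applies to iterates of `resolve`. -/
lemma Recurrent.lt_excess_resolve {ω : Config} (hω : Recurrent ω) (j : ℤ)
    (h : j ∉ noConflict ω) : excess ω j < excess (QueueFlow.resolve ω) j := by
  have hQ := cumService_strictMono hω.1
  have key : ∀ m : ℕ, ∀ j ∉ noConflict ω, (j - lastNoConflict ω j).toNat ≤ m →
      excess ω j < excess ω (lastNoConflict ω j) := by
    intro m
    induction m with
    | zero =>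
      intro j hj hm
      have := (hω.last_spec j).1
      lia
    | succ m ih =>
      intro j hj hm
      obtain ⟨h1, h2, h3⟩ := hω.last_spec j
      rw [mem_noConflict_iff] at hj
      push Not at hj
      obtain ⟨l, hl, hlj⟩ := hj
      have hQj := hQ h1
      have hQl := hQ.monotone (show l + 1 ≤ j by lia)
      rw [cumService_add_one] at hQl
      rcases lt_trichotomy l (lastNoConflict ω j) with h | h | h
      · have := mem_noConflict_iff.1 h2 l h
        simp only [excess]
        linarith
      · simp only [excess]
        rw [h] at hlj hQl
        linarith
      · have hl' : l ∉ noConflict ω := fun hc => by have := h3 l hl hc; lia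
        obtain ⟨g1, g2, g3⟩ := hω.last_spec l
        have e : lastNoConflict ω l = lastNoConflict ω j :=
          le_antisymm (h3 _ (g1.trans hl) g2) (g3 _ h h2)
        have := ih l hl' (by rw [e]; lia)
        rw [e] at this
        simp only [excess] at this ⊢
        linarith
  rw [hω.excess_resolve h]
  exact key _ j h le_rfl

lemma Recurrent.le_excess_resolve {ω : Config} (hω : Recurrent ω) (j : ℤ) :
    excess ω j ≤ excess (QueueFlow.resolve ω) j := by
  by_cases h : j ∈ noConflict ω
  · exact (excess_resolve_of_mem h).ge
  · exact (hω.lt_excess_resolve j h).le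

lemma iterate_resolve_snd (ω : Config) (n : ℕ) : (resolve^[n] ω).2 = ω.2 := by
  induction n with
  | zero => rfl
  | succ n ih => rw [Function.iterate_succ_apply', ← ih]; rfl

/-- Each iteration passes a large excess on to the next customer: after one step the excess of j is
at least the excess that j - 1 had before it. A customer that never moves must thus have had the
largest excess so far. -/
lemma Recurrent.exists_le_excess_iterate {ω : Config} (hω : Recurrent ω) (k : ℕ) :
    ∀ j : ℤ, ∃ n, excess ω (j - k) ≤ excess (QueueFlow.resolve^[n] ω) j := by
  induction k with
  | zero => exact fun j => ⟨0, by simp⟩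
  | succ k ih =>
    intro j
    obtain ⟨n, hn⟩ := ih (j - 1)
    refine ⟨n + 1, ?_⟩
    rw [show j - ((k + 1 : ℕ) : ℤ) = j - 1 - k by push_cast; ring,
      Function.iterate_succ_apply']
    have hr := hω.iterate n
    set ω' := QueueFlow.resolve^[n] ω
    by_cases h : j ∈ noConflict ω'
    · rw [excess_resolve_of_mem h]
      have h1 := mem_noConflict_iff.1 h (j - 1) (by lia)
      have h2 := cumService_add_one ω'.2 (j - 1)
      rw [sub_add_cancel] at h2
      simp only [excess] at hn ⊢
      linarith
    · obtain ⟨h1, h2, h3⟩ := hr.last_spec j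
      rw [hr.excess_resolve h]
      refine hn.trans ?_
      by_cases h' : j - 1 ∈ noConflict ω'
      · rw [le_antisymm (by lia) (h3 _ (by lia) h')]
      -- Here j and j - 1 are both in conflict and are queued behind the same customer, so they end
      -- with the same excess.
      · obtain ⟨g1, g2, g3⟩ := hr.last_spec (j - 1)
        have hne : lastNoConflict ω' j ≠ j - 1 := fun hc => h' (hc ▸ h2)
        have e : lastNoConflict ω' (j - 1) = lastNoConflict ω' j :=
          le_antisymm (h3 _ (by lia) g2) (g3 _ (by lia) h2)
        have := hr.le_excess_resolve (j - 1)
        rwa [hr.excess_resolve h', e] at this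

/-- The heads of clusters are the customers that find the server idle. -/
theorem Recurrent.isHead_iff {ω : Config} (hω : Recurrent ω) (i : ℤ) :
    IsHead ω i ↔ FindsIdle ω i := by
  constructor
  · intro h l hl
    obtain ⟨n, hn⟩ := hω.exists_le_excess_iterate (i - l).toNat i
    have hi : (((i - l).toNat : ℕ) : ℤ) = i - l := Int.toNat_of_nonneg (by lia)
    rw [hi, sub_sub_cancel] at hn
    refine hn.trans_eq ?_
    simp only [excess, h n, iterate_resolve_snd]
  · intro h n
    have : FindsIdle (QueueFlow.resolve^[n] ω) i ∧ (QueueFlow.resolve^[n] ω).1 i = ω.1 i := by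
      induction n with
      | zero => exact ⟨h, rfl⟩
      | succ n ih =>
        rw [Function.iterate_succ_apply']
        exact ⟨ih.1.resolve (hω.iterate n),
          (resolve_of_mem (ih.1.mem_noConflict (hω.iterate n).1)).trans ih.2⟩
    exact this.2

/-- A customer that is not a record lies strictly below some earlier one; descending along such
customers leads to i or to something before it, and the record at i dominates both. -/
lemma FindsIdle.forall_not_iff {ω : Config} {i : ℤ} (h : FindsIdle ω i) (j : ℤ) :
    (∀ k, i < k → k ≤ j → ¬ FindsIdle ω k) ↔ ∀ k, i < k → k ≤ j → excess ω k < excess ω i := by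
  constructor
  · intro H
    have key : ∀ m : ℕ, ∀ k, i < k → k ≤ j → (k - i).toNat ≤ m → excess ω k < excess ω i := by
      intro m
      induction m with
      | zero => intro k hk _ hm; lia
      | succ m ih =>
        intro k hk hkj hm
        have := H k hk hkj
        simp only [FindsIdle] at this
        push Not at this
        obtain ⟨l, hl, hlk⟩ := this
        rcases lt_trichotomy l i with h' | h' | h'
        · exact hlk.trans_le (h l h')
        · rwa [h'] at hlk
        · exact hlk.trans (ih l h' (by lia) (by lia))
    exact fun k hk hkj => key _ k hk hkj le_rfl
  · exact fun H k hk hkj hc => (H k hk hkj).not_ge (hc i hk)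

/-- Customer `j` is in service at `x` in the busy period started by `i`, in terms of records. -/
lemma Recurrent.inServiceAt_iff {ω : Config} (hω : Recurrent ω) {x : ℝ} {i j : ℤ} :
    InServiceAt ω x i j ↔ FindsIdle ω i ∧ i ≤ j ∧
      (∀ k, i < k → k ≤ j → excess ω k < excess ω i) ∧
      excess ω i + cumService ω.2 j < x ∧ x < excess ω i + cumService ω.2 (j + 1) := by
  unfold InServiceAt
  simp only [hω.isHead_iff]
  refine and_congr_right fun h1 => and_congr_right fun h2 => ?_
  rw [h1.forall_not_iff j, sum_Ico_eq_cumService _ h2, sum_Icc_eq_cumService _ h2]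
  simp only [excess, sub_add_eq_add_sub, add_sub_assoc]

lemma Recurrent.inServiceAt_unique {ω : Config} (hω : Recurrent ω) {x : ℝ} {i j i' j' : ℤ}
    (h : InServiceAt ω x i j) (h' : InServiceAt ω x i' j') : i = i' ∧ j = j' := by
  have hQ := (cumService_strictMono hω.1).monotone
  wlog hle : i ≤ i' generalizing i i' j j'
  · exact (this h' h (by lia)).imp Eq.symm Eq.symm
  rw [hω.inServiceAt_iff] at h h'
  obtain ⟨a1, a2, a3, a4, a5⟩ := h
  obtain ⟨b1, b2, b3, b4, b5⟩ := h'
  rcases hle.lt_or_eq with hlt | rfl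
  · exfalso
    have hj : j < i' := by
      by_contra hc
      exact (a3 i' hlt (by lia)).not_ge (b1 i hlt)
    have h1 := b1 i hlt
    have h2 := hQ (show j + 1 ≤ j' by lia)
    linarith
  · refine ⟨rfl, ?_⟩
    rcases lt_trichotomy j j' with h | h | h
    · have := hQ (show j + 1 ≤ j' by lia)
      linarith
    · exact h
    · have := hQ (show j' + 1 ≤ j by lia)
      linarith

/-- Far enough back the excess stays below its value at j - 1, so its maximum over a finite window
ending at j - 1 is a record. -/
lemma recurrent_of_tendsto {ω : Config} (hη : ∀ i, 0 < ω.2 i)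
    (h : Tendsto (excess ω) atBot atBot) : Recurrent ω := by
  refine ⟨hη, fun j => ?_⟩
  obtain ⟨a, ha⟩ := eventually_atBot.1 (h.eventually_lt_atBot (excess ω (j - 1)))
  obtain ⟨i, hi, hmax⟩ := Finset.exists_max_image (Finset.Icc (min a (j - 1)) (j - 1)) (excess ω)
    ⟨j - 1, by simp⟩
  simp only [Finset.mem_Icc] at hi hmax
  refine ⟨i, by lia, fun l hl => ?_⟩
  by_cases hla : min a (j - 1) ≤ l
  · exact hmax l ⟨hla, by lia⟩
  · exact (ha l (by lia)).le.trans (hmax (j - 1) ⟨by simp, le_rfl⟩)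

/-! ### Counting points -/

/-- Increasing sequences without accumulation points, unbounded in both directions. -/
def IsProper (z : ℤ → ℝ) : Prop :=
  StrictMono z ∧ Tendsto z atTop atTop ∧ Tendsto z atBot atBot

lemma IsProper.finite {z : ℤ → ℝ} (hz : IsProper z) {B : Set ℝ} (hB : Bornology.IsBounded B) :
    {i | z i ∈ B}.Finite := by
  obtain ⟨a, ha⟩ := hB.bddBelow
  obtain ⟨b, hb⟩ := hB.bddAbove
  obtain ⟨i, hi⟩ := eventually_atBot.1 (hz.2.2.eventually_lt_atBot a)
  obtain ⟨j, hj⟩ := eventually_atTop.1 (hz.2.1.eventually_gt_atTop b)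
  refine (Set.finite_Icc i j).subset fun k hk => ⟨?_, ?_⟩
  · by_contra h
    exact (hi k (by lia)).not_ge (ha hk)
  · by_contra h
    exact (hj k (by lia)).not_ge (hb hk)

/-- Number of indices in `L` of points in `B`. -/
def countOn (L : Set ℤ) (z : ℤ → ℝ) (B : Set ℝ) : ℕ := {i | i ∈ L ∧ z i ∈ B}.ncard

lemma countOn_univ (z : ℤ → ℝ) (B : Set ℝ) : countOn Set.univ z B = pointCount B z := by
  simp [countOn, pointCount]

lemma IsProper.finite_on {z : ℤ → ℝ} (hz : IsProper z) {B : Set ℝ} (hB : Bornology.IsBounded B)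
    (L : Set ℤ) : {i | i ∈ L ∧ z i ∈ B}.Finite := (hz.finite hB).subset fun _ h => h.2

lemma tsum_indicator_one_eq_encard {ι : Type*} (s : Set ι) :
    ∑' i, s.indicator (1 : ι → ENNReal) i = (s.encard : ENNReal) := by
  rw [← ENNReal.tsum_set_one, ← tsum_subtype]
  rfl

lemma measurable_countOn (L : Set ℤ) {B : Set ℝ} (hB : MeasurableSet B) :
    Measurable fun z => countOn L z B := by
  classical
  -- The default values agree: for infinitely many points `ncard` is 0, and so is `toReal` of the
  -- infinite sum.
  have h : (fun z => countOn L z B) = fun z : ℤ → ℝ =>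
      ⌊(∑' i, (if i ∈ L then B.indicator (1 : ℝ → ENNReal) (z i) else 0)).toReal⌋₊ := by
    funext z
    have : ∑' i, (if i ∈ L then B.indicator (1 : ℝ → ENNReal) (z i) else 0) =
        ({i | i ∈ L ∧ z i ∈ B}.encard : ENNReal) := by
      rw [← tsum_indicator_one_eq_encard]
      refine tsum_congr fun i => ?_
      by_cases h1 : i ∈ L <;> by_cases h2 : z i ∈ B <;> simp [h1, h2]
    rw [this, countOn]
    by_cases hf : {i | i ∈ L ∧ z i ∈ B}.Finite
    · rw [← hf.cast_ncard_eq]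
      simp
    · rw [Set.Infinite.ncard hf, Set.Infinite.encard_eq hf]
      simp
  rw [h]
  refine Nat.measurable_floor.comp (Measurable.ennreal_toReal (Measurable.tsum fun i => ?_))
  split_ifs
  · exact (measurable_one.indicator hB).comp (measurable_pi_apply i)
  · exact measurable_const

lemma measurable_pointCount {B : Set ℝ} (hB : MeasurableSet B) : Measurable (pointCount B) := by
  simpa only [countOn_univ] using measurable_countOn Set.univ hB

lemma countOn_fiber {K : Type*} [Fintype K] {z : ℤ → ℝ} (hz : IsProper z)
    {D : Set ℝ} (hD : Bornology.IsBounded D) (σ : ℝ → K) (s : Set K) [DecidablePred (· ∈ s)]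
    [DecidableEq K] (L : Set ℤ) :
    countOn L z (D ∩ σ ⁻¹' s) = ∑ k, if k ∈ s then countOn L z (D ∩ σ ⁻¹' {k}) else 0 := by
  have hf (t : Set K) [DecidablePred (· ∈ t)] : countOn L z (D ∩ σ ⁻¹' t) =
      ((hz.finite_on hD L).toFinset.filter fun i => σ (z i) ∈ t).card := by
    rw [countOn, ← Set.ncard_coe_finset]
    congr 1
    ext i
    simp [and_assoc]
  simp only [hf]
  rw [Finset.card_eq_sum_card_fiberwise (f := fun i => σ (z i)) (t := Finset.univ) (by simp)]
  refine Finset.sum_congr rfl fun k _ => ?_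
  rw [Finset.filter_filter]
  split_ifs with h
  · congr 1
    ext i
    simp only [Finset.mem_filter, Set.mem_singleton_iff]
    constructor
    · exact fun h' => ⟨h'.1, h'.2.2⟩
    · exact fun h' => ⟨h'.1, by rw [h'.2]; exact h, h'.2⟩
  · rw [Finset.card_eq_zero, Finset.filter_eq_empty_iff]
    rintro i - ⟨h1, h2⟩
    exact h (h2 ▸ h1)

lemma countOn_compl_singleton_of_mem {z : ℤ → ℝ} (hz : IsProper z) {B : Set ℝ}
    (hB : Bornology.IsBounded B) {i : ℤ} (hi : z i ∈ B) :
    pointCount B z = countOn {i}ᶜ z B + 1 := by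
  have : {l | z l ∈ B} = insert i {l | l ∈ ({i}ᶜ : Set ℤ) ∧ z l ∈ B} := by
    ext l
    by_cases h : l = i <;> simp [h, hi]
  rw [pointCount, this, Set.ncard_insert_of_notMem (by simp) (hz.finite_on hB _), countOn]

lemma countOn_compl_singleton_of_notMem {z : ℤ → ℝ} {B : Set ℝ} {i : ℤ} (hi : z i ∉ B) :
    countOn {i}ᶜ z B = pointCount B z := by
  rw [countOn, pointCount]
  congr 1
  ext l
  simp only [Set.mem_compl_iff, Set.mem_singleton_iff, Set.mem_ofPred_eq, and_iff_right_iff_imp]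
  rintro h rfl
  exact hi h

/-! ### Mecke's formula -/

lemma succ_mul_poissonMeasure (r : NNReal) (n : ℕ) :
    (n + 1 : ENNReal) * poissonMeasure r {n + 1} = r * poissonMeasure r {n} := by
  rw [poissonMeasure_singleton, poissonMeasure_singleton]
  rw [show (n + 1 : ENNReal) = ENNReal.ofReal (n + 1) by
      rw [ENNReal.ofReal_add (by positivity) zero_le_one]; simp,
    show (r : ENNReal) = ENNReal.ofReal r by simp,
    ← ENNReal.ofReal_mul (by positivity), ← ENNReal.ofReal_mul (by positivity)]
  congr 1
  rw [Nat.factorial_succ]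
  push_cast
  field_simp
  ring

variable {m : Measure ℝ} {P : Measure (ℤ → ℝ)}

lemma IsPoissonProcess.isProper (hP : IsPoissonProcess m P) : ∀ᵐ z ∂P, IsProper z :=
  hP.config.mono fun _ h => ⟨h.1, h.2.1, h.2.2.1⟩

lemma IsPoissonProcess.measure_pointCount_eq (hP : IsPoissonProcess m P) {K : Type*} [Fintype K]
    {D : K → Set ℝ} (hD : ∀ k, MeasurableSet (D k)) (hb : ∀ k, Bornology.IsBounded (D k))
    (hd : Pairwise fun k l => Disjoint (D k) (D l)) (n : K → ℕ) :
    P {z | (fun k => pointCount (D k) z) = n} =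
      ∏ k, poissonMeasure (m (D k)).toNNReal {n k} := by
  let e := Fintype.equivFin K
  have h := hP.indep (Fintype.card K) (fun k => D (e.symm k)) (fun k => hD _) (fun k => hb _)
    (fun k l hkl => hd (e.symm.injective.ne hkl))
  have h2 := h.measure_inter_preimage_eq_mul Finset.univ (sets := fun k => {n (e.symm k)})
    (fun _ _ => MeasurableSet.singleton _)
  rw [← e.symm.prod_comp]
  have h3 : {z | (fun k => pointCount (D k) z) = n} =
      ⋂ k ∈ Finset.univ, (fun z => pointCount (D (e.symm k)) z) ⁻¹' {n (e.symm k)} := by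
    ext z
    simp only [Finset.mem_univ, Set.iInter_true, Set.mem_iInter, Set.mem_preimage,
      Set.mem_singleton_iff, Set.mem_ofPred_eq, funext_iff]
    exact e.symm.forall_congr_right.symm
  rw [h3, h2]
  refine Finset.prod_congr rfl fun k _ => ?_
  rw [← hP.map_pointCount _ (hD _) (hb _), Measure.map_apply (measurable_pointCount (hD _))
    (MeasurableSet.singleton _)]

/-- For disjoint sets the counts are independent Poisson variables. The number of points in D b
whose removal leaves the counts n is n b + 1 if the counts are n with one more point in D b, and 0
otherwise, so the identity reduces to `succ_mul_poissonMeasure`. -/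
lemma IsPoissonProcess.mecke_atom (hP : IsPoissonProcess m P) {K : Type*} [Fintype K]
    {D : K → Set ℝ} (hD : ∀ k, MeasurableSet (D k)) (hb : ∀ k, Bornology.IsBounded (D k))
    (hm : ∀ k, m (D k) ≠ ⊤) (hd : Pairwise fun k l => Disjoint (D k) (D l)) (b : K) :
    (Measure.sum fun i : ℤ =>
        (P.restrict {z | z i ∈ D b}).map fun z k => countOn {i}ᶜ z (D k)) =
      m (D b) • P.map fun z k => pointCount (D k) z := by
  classical
  have hmeas (i : ℤ) : Measurable fun (z : ℤ → ℝ) k => countOn {i}ᶜ z (D k) :=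
    measurable_pi_lambda _ fun k => measurable_countOn _ (hD k)
  have hmeas' : Measurable fun (z : ℤ → ℝ) k => pointCount (D k) z :=
    measurable_pi_lambda _ fun k => measurable_pointCount (hD k)
  have hset (i : ℤ) : MeasurableSet {z : ℤ → ℝ | z i ∈ D b} := measurable_pi_apply i (hD b)
  refine Measure.ext_of_singleton fun n => ?_
  rw [Measure.sum_apply _ (MeasurableSet.singleton _), Measure.smul_apply, smul_eq_mul,
    Measure.map_apply hmeas' (MeasurableSet.singleton _)]
  have e1 : P ((fun z k => pointCount (D k) z) ⁻¹' {n}) =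
      ∏ k, poissonMeasure (m (D k)).toNNReal {n k} :=
    hP.measure_pointCount_eq hD hb hd n
  let n' := Function.update n b (n b + 1)
  have e2 : P {z | (fun k => pointCount (D k) z) = n'} =
      ∏ k, poissonMeasure (m (D k)).toNNReal {n' k} :=
    hP.measure_pointCount_eq hD hb hd n'
  have hA : MeasurableSet {z : ℤ → ℝ | (fun k => pointCount (D k) z) = n'} :=
    hmeas' (MeasurableSet.singleton n')
  have e3 (i : ℤ) : ((P.restrict {z | z i ∈ D b}).map fun z k => countOn {i}ᶜ z (D k)) {n} =
      ∫⁻ z, {z | z i ∈ D b}.indicator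
        ({z | (fun k => pointCount (D k) z) = n'}.indicator 1) z ∂P := by
    rw [Measure.map_apply (hmeas i) (MeasurableSet.singleton _),
      Measure.restrict_apply (hmeas i (MeasurableSet.singleton _)),
      Set.indicator_indicator, lintegral_indicator_one ((hset i).inter hA)]
    refine measure_congr ?_
    filter_upwards [hP.isProper] with z hz
    refine propext ?_
    change (fun k => countOn {i}ᶜ z (D k)) = n ∧ z i ∈ D b ↔
      z i ∈ D b ∧ (fun k => pointCount (D k) z) = n'
    rw [and_comm]
    refine and_congr_right fun hi => ?_
    have hk (k : K) : pointCount (D k) z = countOn {i}ᶜ z (D k) + if k = b then 1 else 0 := by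
      split_ifs with h
      · subst h
        exact countOn_compl_singleton_of_mem hz (hb k) hi
      · rw [countOn_compl_singleton_of_notMem (Set.disjoint_left.1 (hd (Ne.symm h)) hi), add_zero]
    simp only [funext_iff, hk]
    refine forall_congr' fun k => ?_
    by_cases h : k = b
    · subst h
      simp [n']
    · simp [n', h]
  simp only [e3]
  rw [← lintegral_tsum fun i => ((measurable_one.indicator hA).indicator (hset i)).aemeasurable]
  have e4 : ∀ᵐ z ∂P, ∑' i : ℤ, {z | z i ∈ D b}.indicator
        ({z | (fun k => pointCount (D k) z) = n'}.indicator (1 : (ℤ → ℝ) → ENNReal)) z =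
      (n b + 1) * {z | (fun k => pointCount (D k) z) = n'}.indicator 1 z := by
    filter_upwards [hP.isProper] with z hz
    by_cases h : (fun k => pointCount (D k) z) = n'
    · have h1 : ∑' i : ℤ, {z | z i ∈ D b}.indicator
          ({z | (fun k => pointCount (D k) z) = n'}.indicator (1 : (ℤ → ℝ) → ENNReal)) z =
          ({i | z i ∈ D b}.encard : ENNReal) := by
        rw [← tsum_indicator_one_eq_encard]
        refine tsum_congr fun i => ?_
        by_cases h2 : z i ∈ D b <;> simp [h, h2]
      have h2 : {i | z i ∈ D b}.ncard = n b + 1 := by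
        have := congrFun h b
        simp only [n', Function.update_self] at this
        exact this
      rw [h1, ← (hz.finite (hb b)).cast_ncard_eq, h2]
      simp [h]
    · have : ∀ i : ℤ, {z | z i ∈ D b}.indicator
        ({z | (fun k => pointCount (D k) z) = n'}.indicator (1 : (ℤ → ℝ) → ENNReal)) z = 0 := by
        intro i
        by_cases h2 : z i ∈ D b <;> simp [h, h2]
      simp [this, h]
  rw [lintegral_congr_ae e4, lintegral_const_mul _ (measurable_one.indicator hA),
    lintegral_indicator_one hA, e1, e2, ← Finset.mul_prod_erase _ _ (Finset.mem_univ b),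
    ← Finset.mul_prod_erase _ _ (Finset.mem_univ b), ← mul_assoc, ← mul_assoc]
  congr 1
  · simp only [n', Function.update_self]
    rw [succ_mul_poissonMeasure, ENNReal.coe_toNNReal (hm b)]
  · refine Finset.prod_congr rfl fun k hk => ?_
    simp [n', Function.update_of_ne (Finset.ne_of_mem_erase hk)]

lemma measurable_counts {ι : Type*} (L : Set ℤ) {A : ι → Set ℝ} (hA : ∀ a, MeasurableSet (A a)) :
    Measurable fun (z : ℤ → ℝ) a => countOn L z (A a) :=
  measurable_pi_lambda _ fun a => measurable_countOn L (hA a)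

/-- Cut B and the sets A a into the disjoint atoms of the algebra they generate; their counts are
sums of counts over atoms, and B is a union of atoms. The atoms are indexed by membership patterns,
with `none` standing for B. -/
lemma IsPoissonProcess.mecke_finite (hP : IsPoissonProcess m P)
    (hm : ∀ B : Set ℝ, Bornology.IsBounded B → m B ≠ ⊤) {J : Type*} [Fintype J]
    {A : J → Set ℝ} (hA : ∀ a, MeasurableSet (A a)) (hb : ∀ a, Bornology.IsBounded (A a))
    {B : Set ℝ} (hB : MeasurableSet B) (hBb : Bornology.IsBounded B) {E : Set (J → ℕ)}
    (hE : MeasurableSet E) :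
    ∑' i : ℤ, P ({z | z i ∈ B} ∩ {z | (fun a => countOn {i}ᶜ z (A a)) ∈ E}) =
      m B * P {z | (fun a => pointCount (A a) z) ∈ E} := by
  classical
  let A' : Option J → Set ℝ := fun u => u.elim B A
  have hA' (u : Option J) : MeasurableSet (A' u) := by cases u <;> simp [A', hB, hA]
  have hb' (u : Option J) : Bornology.IsBounded (A' u) := by cases u <;> simp [A', hBb, hb]
  let σ : ℝ → Option J → Prop := fun x u => x ∈ A' u
  -- Intersecting with the union keeps every atom bounded, including the one of the empty pattern.
  let D₀ : Set ℝ := ⋃ u, A' u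
  have hD₀ : Bornology.IsBounded D₀ := (Bornology.isBounded_iUnion).2 hb'
  have hσ : Measurable σ := measurable_pi_lambda _ fun u => measurable_mem.2 (hA' u)
  let D : (Option J → Prop) → Set ℝ := fun k => D₀ ∩ σ ⁻¹' {k}
  have hD (k) : MeasurableSet (D k) :=
    (MeasurableSet.iUnion hA').inter (hσ (MeasurableSet.singleton k))
  have hDb (k) : Bornology.IsBounded (D k) := hD₀.subset Set.inter_subset_left
  have hdisj : Pairwise fun k l => Disjoint (D k) (D l) := by
    intro k l hkl
    refine Set.disjoint_left.2 fun x hx hx' => hkl ?_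
    exact (Set.mem_singleton_iff.1 hx.2).symm.trans (Set.mem_singleton_iff.1 hx'.2)
  have hAD (u : Option J) : A' u = D₀ ∩ σ ⁻¹' {k | k u} := by
    ext x
    exact ⟨fun h => ⟨Set.mem_iUnion.2 ⟨u, h⟩, h⟩, fun h => h.2⟩
  let g : ((Option J → Prop) → ℕ) → J → ℕ := fun c a => ∑ k, if k (some a) then c k else 0
  have hg (L : Set ℤ) {z : ℤ → ℝ} (hz : IsProper z) :
      (fun a => countOn L z (A a)) = g fun k => countOn L z (D k) := by
    funext a
    change countOn L z (A' (some a)) = _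
    rw [hAD, countOn_fiber hz hD₀]
    rfl
  have hgE : MeasurableSet (g ⁻¹' E) := by
    have : Measurable g := measurable_of_countable g
    exact this hE
  have hBD : B = ⋃ k ∈ Finset.univ.filter fun k : Option J → Prop => k none, D k := by
    change A' none = _
    rw [hAD]
    ext x
    simp only [D, Set.mem_iUnion, Finset.mem_filter, Finset.mem_univ, true_and]
    constructor
    · exact fun h => ⟨σ x, h.2, h.1, rfl⟩
    · rintro ⟨k, hk, h1, h2⟩
      refine ⟨h1, ?_⟩
      rw [Set.mem_preimage, Set.mem_singleton_iff] at h2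
      change σ x none
      rw [h2]
      exact hk
  have hset (i : ℤ) (k) : MeasurableSet {z : ℤ → ℝ | z i ∈ D k} := measurable_pi_apply i (hD k)
  have hcE (i : ℤ) : MeasurableSet {z : ℤ → ℝ | (fun k => countOn {i}ᶜ z (D k)) ∈ g ⁻¹' E} :=
    measurable_counts _ hD hgE
  have h1 (i : ℤ) : P ({z | z i ∈ B} ∩ {z | (fun a => countOn {i}ᶜ z (A a)) ∈ E}) =
      ∑ k ∈ Finset.univ.filter fun k : Option J → Prop => k none,
        P ({z | z i ∈ D k} ∩ {z | (fun k => countOn {i}ᶜ z (D k)) ∈ g ⁻¹' E}) := by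
    rw [← measure_biUnion_finset]
    · refine measure_congr ?_
      filter_upwards [hP.isProper] with z hz
      refine propext ?_
      change z i ∈ B ∧ (fun a => countOn {i}ᶜ z (A a)) ∈ E ↔
        z ∈ ⋃ k ∈ Finset.univ.filter fun k : Option J → Prop => k none,
          {z | z i ∈ D k} ∩ {z | (fun k => countOn {i}ᶜ z (D k)) ∈ g ⁻¹' E}
      rw [hg _ hz, hBD]
      simp only [Set.mem_iUnion, Set.mem_inter_iff, Set.mem_ofPred_eq, Set.mem_preimage]
      constructor
      · rintro ⟨⟨k, hk, hk'⟩, h⟩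
        exact ⟨k, hk, hk', h⟩
      · rintro ⟨k, hk, hk', h⟩
        exact ⟨⟨k, hk, hk'⟩, h⟩
    · intro k _ l _ hkl
      exact Set.disjoint_left.2 fun z hz hz' => Set.disjoint_left.1 (hdisj hkl) hz.1 hz'.1
    · exact fun k _ => (hset i k).inter (hcE i)
  have h2 (k) : ∑' i : ℤ, P ({z | z i ∈ D k} ∩ {z | (fun k => countOn {i}ᶜ z (D k)) ∈ g ⁻¹' E}) =
      m (D k) * P {z | (fun k => pointCount (D k) z) ∈ g ⁻¹' E} := by
    have := congrArg (fun μ => μ (g ⁻¹' E))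
      (hP.mecke_atom hD hDb (fun k => hm _ (hDb k)) hdisj k)
    simp only [Measure.smul_apply, smul_eq_mul] at this
    rw [Measure.sum_apply _ hgE, Measure.map_apply (by
      simpa only [countOn_univ] using measurable_counts Set.univ hD) hgE] at this
    refine Eq.trans (tsum_congr fun i => ?_) this
    rw [Measure.map_apply (measurable_counts _ hD) hgE,
      Measure.restrict_apply (measurable_counts _ hD hgE), Set.inter_comm]
    rfl
  have h3 : P {z | (fun k => pointCount (D k) z) ∈ g ⁻¹' E} =
      P {z | (fun a => pointCount (A a) z) ∈ E} := by
    refine measure_congr ?_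
    filter_upwards [hP.isProper] with z hz
    refine propext ?_
    have := hg Set.univ hz
    simp only [countOn_univ] at this
    change (fun k => pointCount (D k) z) ∈ g ⁻¹' E ↔ (fun a => pointCount (A a) z) ∈ E
    rw [this]
    rfl
  simp only [h1]
  rw [Summable.tsum_finsetSum fun _ _ => ENNReal.summable]
  simp only [h2, h3]
  rw [← Finset.sum_mul]
  congr 1
  conv_rhs => rw [hBD]
  rw [measure_biUnion_finset]
  · exact fun k _ l _ hkl => hdisj hkl
  · exact fun k _ => hD k

/-- Finite measures on a product are determined by their finite-dimensional marginals, which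
`mecke_finite` identifies. -/
lemma IsPoissonProcess.mecke_restrict (hP : IsPoissonProcess m P)
    (hm : ∀ B : Set ℝ, Bornology.IsBounded B → m B ≠ ⊤) {ι : Type*}
    {A : ι → Set ℝ} (hA : ∀ a, MeasurableSet (A a)) (hb : ∀ a, Bornology.IsBounded (A a))
    {B : Set ℝ} (hB : MeasurableSet B) (hBb : Bornology.IsBounded B) :
    (Measure.sum fun i : ℤ =>
        (P.restrict {z | z i ∈ B}).map fun z a => countOn {i}ᶜ z (A a)) =
      m B • P.map fun z a => pointCount (A a) z := by
  have := hP.isProbabilityMeasure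
  have hmeas' : Measurable fun (z : ℤ → ℝ) a => pointCount (A a) z := by
    simpa only [countOn_univ] using measurable_counts Set.univ hA
  have : IsFiniteMeasure (m B • P.map fun z a => pointCount (A a) z) :=
    ⟨by
      rw [Measure.smul_apply, smul_eq_mul]
      exact ENNReal.mul_lt_top (hm B hBb).lt_top (measure_lt_top _ _)⟩
  refine IsProjectiveLimit.unique
    (P := fun J : Finset ι => (m B • P.map fun z a => pointCount (A a) z).map J.restrict)
    (fun J => ?_) fun J => rfl
  have hr : Measurable (J.restrict : (ι → ℕ) → J → ℕ) := Finset.measurable_restrict J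
  ext E hE
  rw [Measure.map_apply hr hE, Measure.map_apply hr hE, Measure.sum_apply _ (hr hE),
    Measure.smul_apply, smul_eq_mul, Measure.map_apply hmeas' (hr hE)]
  refine Eq.trans (tsum_congr fun i => ?_)
    (hP.mecke_finite hm (A := fun a : J => A a) (fun a => hA a) (fun a => hb a) hB hBb hE)
  rw [Measure.map_apply (measurable_counts _ hA) (hr hE),
    Measure.restrict_apply (measurable_counts _ hA (hr hE)), Set.inter_comm]
  rfl

/-- Mecke's formula for functions of a point and of the numbers of other points in given sets. -/
theorem IsPoissonProcess.mecke [SFinite m] (hP : IsPoissonProcess m P)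
    (hm : ∀ B : Set ℝ, Bornology.IsBounded B → m B ≠ ⊤) {ι : Type*}
    {A : ι → Set ℝ} (hA : ∀ a, MeasurableSet (A a)) (hb : ∀ a, Bornology.IsBounded (A a))
    {F : ℝ × (ι → ℕ) → ENNReal} (hF : Measurable F) :
    ∑' i : ℤ, ∫⁻ z, F (z i, fun a => countOn {i}ᶜ z (A a)) ∂P =
      ∫⁻ y, ∫⁻ z, F (y, fun a => pointCount (A a) z) ∂P ∂m := by
  have := hP.isProbabilityMeasure
  have hmeas' : Measurable fun (z : ℤ → ℝ) a => pointCount (A a) z := by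
    simpa only [countOn_univ] using measurable_counts Set.univ hA
  have hmi (i : ℤ) : Measurable fun z : ℤ → ℝ => (z i, fun a => countOn {i}ᶜ z (A a)) :=
    (measurable_pi_apply i).prodMk (measurable_counts _ hA)
  let ν := P.map fun z a => pointCount (A a) z
  have : IsProbabilityMeasure ν := Measure.isProbabilityMeasure_map hmeas'.aemeasurable
  -- Both sides agree on products of a bounded set with a measurable set by `mecke_restrict`; these
  -- form a generating π-system.
  have key : m.prod ν = Measure.sum fun i : ℤ =>
      P.map fun z => (z i, fun a => countOn {i}ᶜ z (A a)) := by
    have hspan : m.FiniteSpanningSetsIn {B | MeasurableSet B ∧ Bornology.IsBounded B} :=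
      { set := fun n => Set.Icc (-n : ℝ) n
        set_mem := fun n => ⟨measurableSet_Icc, Metric.isBounded_Icc _ _⟩
        finite := fun n => (hm _ (Metric.isBounded_Icc _ _)).lt_top
        spanning := by
          refine Set.eq_univ_of_forall fun x => Set.mem_iUnion.2 ?_
          obtain ⟨n, hn⟩ := exists_nat_ge |x|
          exact ⟨n, abs_le.1 hn⟩ }
    refine Measure.prod_eq_generateFrom (C := {B | MeasurableSet B ∧ Bornology.IsBounded B})
      (D := {E | MeasurableSet E}) ?_ MeasurableSpace.generateFrom_measurableSet ?_
      MeasurableSpace.isPiSystem_measurableSet hspan ν.toFiniteSpanningSetsIn ?_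
    · refine le_antisymm (MeasurableSpace.generateFrom_le fun B hB => hB.1) ?_
      intro B hB
      have : B = ⋃ n, B ∩ hspan.set n := by rw [← Set.inter_iUnion, hspan.spanning, Set.inter_univ]
      rw [this]
      refine MeasurableSet.iUnion fun n => MeasurableSpace.measurableSet_generateFrom
        ⟨hB.inter (hspan.set_mem n).1, (hspan.set_mem n).2.subset Set.inter_subset_right⟩
    · exact fun B hB C hC _ => ⟨hB.1.inter hC.1, hB.2.subset Set.inter_subset_left⟩
    · intro B hB E hE
      replace hE : MeasurableSet E := hE
      rw [Measure.sum_apply _ (hB.1.prod hE)]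
      have := congrArg (fun μ => μ E) (hP.mecke_restrict hm hA hb hB.1 hB.2)
      simp only [Measure.smul_apply, smul_eq_mul] at this
      rw [Measure.sum_apply _ hE] at this
      refine Eq.trans (tsum_congr fun i => ?_) this
      rw [Measure.map_apply (hmi i) (hB.1.prod hE), Measure.map_apply (measurable_counts _ hA) hE,
        Measure.restrict_apply (measurable_counts _ hA hE), Set.inter_comm]
      rfl
  have h1 := congrArg (fun μ => ∫⁻ p, F p ∂μ) key
  simp only [lintegral_sum_measure, lintegral_map hF (hmi _)] at h1
  rw [← h1, lintegral_prod _ hF.aemeasurable]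
  refine lintegral_congr fun y => ?_
  exact lintegral_map (f := fun c => F (y, c)) (hF.comp measurable_prodMk_left) hmeas'

/-! ### The intensity measure -/

section rate

variable {rate : ℝ → ℝ}

lemma rateMeasure_ne_top (hcont : Continuous rate) {B : Set ℝ} (hB : Bornology.IsBounded B) :
    rateMeasure rate B ≠ ⊤ := by
  obtain ⟨a, ha⟩ := hB.bddBelow
  obtain ⟨b, hb⟩ := hB.bddAbove
  have hsub : B ⊆ Set.Icc a b := fun x hx => ⟨ha hx, hb hx⟩
  refine ne_top_of_le_ne_top ?_ (measure_mono hsub)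
  rw [rateMeasure, withDensity_apply _ measurableSet_Icc]
  exact (hcont.continuousOn.integrableOn_Icc).setLIntegral_lt_top.ne

lemma rateMeasure_Ioo_ne_zero (hcont : Continuous rate) (hpos : ∀ x, 0 < rate x) {a b : ℝ}
    (hab : a < b) : rateMeasure rate (Set.Ioo a b) ≠ 0 := by
  rw [rateMeasure, Ne, withDensity_apply_eq_zero' (by fun_prop)]
  simp [hpos, hab]

lemma rateMeasure_singleton (x : ℝ) : rateMeasure rate {x} = 0 :=
  withDensity_absolutelyContinuous _ _ (measure_singleton x)

instance : SFinite (rateMeasure rate) := by unfold rateMeasure; infer_instance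

lemma pointFlow_zero (hcont : Continuous rate) (hpos : ∀ x, 0 < rate x) (x : ℝ) :
    pointFlow rate 0 x = x := by
  have hinj : Function.Injective fun y : ℝ => ∫ u in x..y, rate u := by
    refine StrictMono.injective fun a b hab => ?_
    have := intervalIntegral.integral_interval_sub_left (μ := volume)
      (hcont.intervalIntegrable x b) (hcont.intervalIntegrable x a)
    have h2 := intervalIntegral.intervalIntegral_pos_of_pos (hcont.intervalIntegrable a b) hpos hab
    change ∫ u in x..a, rate u < ∫ u in x..b, rate u
    linarith
  have := Function.leftInverse_invFun hinj x
  simpa [pointFlow] using this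

lemma configFlow_zero (hcont : Continuous rate) (hpos : ∀ x, 0 < rate x) {ω : Config}
    (hz : StrictMono ω.1) (h1 : ω.1 (-1) ≤ 0) (h0 : 0 < ω.1 0) : configFlow rate 0 ω = ω := by
  have : firstPos ω.1 = 0 := by
    refine IsLeast.csInf_eq ⟨h0, fun i hi => ?_⟩
    by_contra h
    exact ((hz.monotone (show i ≤ -1 by lia)).trans h1).not_gt hi
  simp [configFlow, pointFlow_zero hcont hpos, this]

end rate

/-! ### Shifts of the sequence of service times -/

lemma shiftBy_shiftBy (i j : ℤ) (w : ℤ → ℝ) : shiftBy i (shiftBy j w) = shiftBy (i + j) w := by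
  funext k
  simp [shiftBy, add_assoc]

lemma shiftBy_zero (w : ℤ → ℝ) : shiftBy 0 w = w := by
  funext k
  simp [shiftBy]

lemma measurable_shiftBy (i : ℤ) : Measurable (shiftBy i) :=
  measurable_pi_lambda _ fun _ => measurable_pi_apply _

/-- The shift by `i` as a measurable equivalence. -/
def shiftEquiv (i : ℤ) : (ℤ → ℝ) ≃ᵐ (ℤ → ℝ) where
  toFun := shiftBy i
  invFun := shiftBy (-i)
  left_inv w := by rw [shiftBy_shiftBy, neg_add_cancel, shiftBy_zero]
  right_inv w := by rw [shiftBy_shiftBy, add_neg_cancel, shiftBy_zero]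
  measurable_toFun := measurable_shiftBy i
  measurable_invFun := measurable_shiftBy (-i)

variable {T : Measure (ℤ → ℝ)}

lemma IsServiceProcess.measurePreserving_shiftBy (hT : IsServiceProcess T) (i : ℤ) :
    MeasurePreserving (shiftBy i) T T := by
  have h1 : MeasurePreserving (shiftBy 1) T T := hT.ergodic.toMeasurePreserving
  have hn (n : ℕ) : MeasurePreserving (shiftBy n) T T := by
    induction n with
    | zero =>
      have : shiftBy ((0 : ℕ) : ℤ) = id := funext fun w => shiftBy_zero w
      rw [this]
      exact MeasurePreserving.id T
    | succ n ih =>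
      have : shiftBy ((n + 1 : ℕ) : ℤ) = shiftBy n ∘ shiftBy 1 := by
        funext w
        simp [shiftBy_shiftBy]
      rw [this]
      exact ih.comp h1
  obtain ⟨n, rfl | rfl⟩ := i.eq_nat_or_neg
  · exact hn n
  · exact (hn n).symm (shiftEquiv n)

lemma IsServiceProcess.lintegral_shiftBy (hT : IsServiceProcess T) (i : ℤ)
    (f : (ℤ → ℝ) → ENNReal) : ∫⁻ η, f (shiftBy i η) ∂T = ∫⁻ η, f η ∂T :=
  (hT.measurePreserving_shiftBy i).lintegral_comp_emb (shiftEquiv i).measurableEmbedding f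

/-- By Poincaré recurrence, if η_0 exceeds 1/(p+1) then so do infinitely many later service times,
and their sum diverges. -/
lemma IsServiceProcess.ae_exists_le_cumService (hT : IsServiceProcess T) :
    ∀ᵐ η ∂T, ∀ R : ℝ, ∃ n : ℕ, R ≤ cumService η n := by
  have := hT.isProbabilityMeasure
  have hc : Conservative seqShift T := hT.ergodic.toMeasurePreserving.conservative
  have h : ∀ᵐ η ∂T, ∀ p : ℕ, (1 / (p + 1) : ℝ) < η 0 →
      ∃ᶠ n in atTop, (1 / (p + 1) : ℝ) < seqShift^[n] η 0 :=
    ae_all_iff.2 fun p => by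
      have hs : MeasurableSet {η : ℤ → ℝ | (1 / (p + 1) : ℝ) < η 0} :=
        measurableSet_lt measurable_const (measurable_pi_apply 0)
      exact hc.ae_mem_imp_frequently_image_mem hs.nullMeasurableSet
  filter_upwards [h, hT.pos] with η hη hpos
  have hit (n : ℕ) : seqShift^[n] η = shiftBy n η := by
    induction n with
    | zero => exact (shiftBy_zero η).symm
    | succ n ih =>
      rw [Function.iterate_succ_apply', ih]
      change shiftBy 1 (shiftBy n η) = _
      rw [shiftBy_shiftBy]
      congr 1
      push_cast
      ring
  have hQ (n : ℕ) : cumService η n = ∑ k ∈ Finset.range n, η k := by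
    induction n with
    | zero => simp [cumService_zero]
    | succ n ih =>
      rw [Finset.sum_range_succ, ← ih]
      exact_mod_cast cumService_add_one η n
  by_contra! hcon
  obtain ⟨R, hR⟩ := hcon
  have hsum : Summable fun k : ℕ => η k :=
    summable_of_sum_range_le (c := R) (fun k => (hpos k).le) fun n => by
      rw [← hQ]; exact (hR n).le
  obtain ⟨p, hp⟩ := exists_nat_one_div_lt (hpos 0)
  have hev := hsum.tendsto_atTop_zero.eventually_lt_const (show (0 : ℝ) < 1 / (p + 1) by positivity)
  obtain ⟨n, hn1, hn2⟩ := ((hη p hp).and_eventually hev).exists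
  rw [hit] at hn1
  simp only [shiftBy, zero_add] at hn1
  exact lt_asymm hn1 hn2

/-! ### Stability -/

lemma pointCount_Ioo_lt_of_strictMono {z : ℤ → ℝ} (hz : StrictMono z) (h0 : 0 < z 0) {k : ℕ}
    (hk : 1 ≤ k) {a : ℝ} (h : z (-k) < a) : pointCount (Set.Ioo a 0) z < k := by
  have hsub : {i | z i ∈ Set.Ioo a 0} ⊆ (Finset.Ioo (-(k : ℤ)) 0 : Finset ℤ) := by
    intro i hi
    rw [Finset.coe_Ioo]
    exact ⟨hz.lt_iff_lt.1 (h.trans hi.1), hz.lt_iff_lt.1 (lt_trans hi.2 h0)⟩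
  have := Set.ncard_le_ncard hsub
  rw [Set.ncard_coe_finset, Int.card_Ioo] at this
  unfold pointCount
  lia

variable {rate : ℝ → ℝ}

/-- This is the case t = 0 of the no-overload condition, expressed through counts so that Mecke's
formula can be applied for fixed service times. -/
lemma ae_eventually_pointCount_lt (hcont : Continuous rate) (hpos : ∀ x, 0 < rate x)
    (hP : IsPoissonProcess (rateMeasure rate) P) (hT : IsServiceProcess T)
    (hload : NoOverload rate (P.prod T)) :
    ∀ᵐ η ∂T, ∀ᵐ z ∂P, ∀ᶠ k : ℕ in atTop,
      pointCount (Set.Ioo (cumService η (-k)) 0) z < k := by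
  have := hP.isProbabilityMeasure
  have := hT.isProbabilityMeasure
  have h1 : ∀ᵐ ω ∂P.prod T, configFlow rate 0 ω ∈ stableConfigs :=
    hload.mono fun ω h => Set.mem_iInter.1 h 0
  have h2 : ∀ᵐ p ∂T.prod P, configFlow rate 0 p.swap ∈ stableConfigs :=
    (Measure.measurePreserving_swap (μ := T) (ν := P)).quasiMeasurePreserving.ae h1
  filter_upwards [Measure.ae_ae_of_ae_prod h2] with η hη
  filter_upwards [hη, hP.config] with z hz hc
  rw [Prod.swap_prod_mk, configFlow_zero hcont hpos hc.1 hc.2.2.2.1 hc.2.2.2.2] at hz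
  have hf : {k : ℕ | 1 ≤ k ∧ ¬ (∑ i ∈ Finset.Ico (-(k : ℤ)) 0, η i + z (-(k : ℤ)) < 0)}.Finite := hz
  filter_upwards [hf.eventually_cofinite_notMem.filter_mono Nat.cofinite_eq_atTop.ge,
    eventually_ge_atTop 1] with k hk hk1
  have hk2 : ∑ i ∈ Finset.Ico (-(k : ℤ)) 0, η i + z (-(k : ℤ)) < 0 := by
    by_contra hc
    exact hk ⟨hk1, hc⟩
  rw [sum_Ico_eq_cumService _ (by lia), cumService_zero] at hk2
  exact pointCount_Ioo_lt_of_strictMono hc.1 hc.2.2.2.2 hk1 (by linarith)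

/-- An almost sure property of the process survives adding a point at almost every position: by
Mecke's formula, m(B) times the probability that the bound fails with c + 1 equals the expected
number of points in B whose removal leaves a configuration failing it. That number is almost surely
0 by the bound with c, while m(B) > 0. -/
lemma ae_eventually_pointCount_add_lt (hcont : Continuous rate) (hpos : ∀ x, 0 < rate x)
    (hP : IsPoissonProcess (rateMeasure rate) P) {η : ℤ → ℝ} (hη : ∀ i, 0 < η i)
    (h : ∀ᵐ z ∂P, ∀ᶠ k : ℕ in atTop, pointCount (Set.Ioo (cumService η (-k)) 0) z < k) (c : ℕ) :
    ∀ᵐ z ∂P, ∀ᶠ k : ℕ in atTop, pointCount (Set.Ioo (cumService η (-k)) 0) z + c < k := by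
  classical
  have hQ := cumService_strictMono hη
  induction c with
  | zero => simpa using h
  | succ c ih =>
    let U : Set (ℕ → ℕ) := {C | ∀ᶠ k : ℕ in atTop, C k + (c + 1) < k}
    have hU : MeasurableSet U := by
      have : U = ⋃ N : ℕ, ⋂ k : ℕ, ⋂ _ : N ≤ k, {C | C k + (c + 1) < k} := by
        ext C
        simp [U, eventually_atTop]
      rw [this]
      refine MeasurableSet.iUnion fun N => MeasurableSet.iInter fun k => MeasurableSet.iInter fun _ => ?_
      have hk : Measurable fun C : ℕ → ℕ => C k := measurable_pi_apply k
      exact hk (.of_discrete (s := {n : ℕ | n + (c + 1) < k}))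
    -- This interval lies in all the counting intervals with k ≥ 1, so removing a point of B lowers
    -- each of those counts by one.
    let B : Set ℝ := Set.Ioo (cumService η (-1)) 0
    have hB0 : cumService η (-1) < 0 := by
      rw [← cumService_zero η]
      exact hQ (by lia)
    let F : ℝ × (ℕ → ℕ) → ENNReal := (B ×ˢ Uᶜ).indicator 1
    have hF : Measurable F := measurable_one.indicator (measurableSet_Ioo.prod hU.compl)
    have hM := hP.mecke (fun B hB => rateMeasure_ne_top hcont hB)
      (A := fun k : ℕ => Set.Ioo (cumService η (-k)) 0) (fun _ => measurableSet_Ioo)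
      (fun _ => Metric.isBounded_Ioo _ _) hF
    have hL : ∑' i : ℤ, ∫⁻ z, F (z i, fun k : ℕ =>
        countOn {i}ᶜ z (Set.Ioo (cumService η (-k)) 0)) ∂P = 0 := by
      refine ENNReal.tsum_eq_zero.2 fun i => ?_
      refine (lintegral_congr_ae (g := fun _ => 0) ?_).trans lintegral_zero
      filter_upwards [ih, hP.isProper] with z hz hzp
      refine Set.indicator_of_notMem ?_ _
      rintro ⟨h1, h2⟩
      refine h2 ?_
      change ∀ᶠ k : ℕ in atTop, countOn {i}ᶜ z (Set.Ioo (cumService η (-k)) 0) + (c + 1) < k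
      filter_upwards [hz, eventually_ge_atTop 1] with k hk hk1
      have hi : z i ∈ Set.Ioo (cumService η (-k)) 0 :=
        ⟨(hQ.monotone (show -(k : ℤ) ≤ -1 by lia)).trans_lt h1.1, h1.2⟩
      rw [countOn_compl_singleton_of_mem hzp (Metric.isBounded_Ioo _ _) hi] at hk
      lia
    rw [hL] at hM
    have hmeas : Measurable fun (z : ℤ → ℝ) (k : ℕ) =>
        pointCount (Set.Ioo (cumService η (-k)) 0) z := by
      simpa only [countOn_univ] using measurable_counts Set.univ
        (A := fun k : ℕ => Set.Ioo (cumService η (-k)) 0) fun _ => measurableSet_Ioo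
    let W : Set (ℤ → ℝ) := {z | (fun k : ℕ => pointCount (Set.Ioo (cumService η (-k)) 0) z) ∈ Uᶜ}
    have hW : MeasurableSet W := hmeas hU.compl
    have hR (y : ℝ) : ∫⁻ z, F (y, fun k : ℕ => pointCount (Set.Ioo (cumService η (-k)) 0) z) ∂P =
        B.indicator (fun _ => P W) y := by
      by_cases hy : y ∈ B
      · rw [Set.indicator_of_mem hy, ← lintegral_indicator_one hW]
        refine lintegral_congr fun z => ?_
        by_cases hz : (fun k : ℕ => pointCount (Set.Ioo (cumService η (-k)) 0) z) ∈ Uᶜ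
        · rw [Set.indicator_of_mem (show z ∈ W from hz)]
          exact Set.indicator_of_mem (show _ ∈ B ×ˢ Uᶜ from ⟨hy, hz⟩) _
        · rw [Set.indicator_of_notMem (show z ∉ W from hz)]
          exact Set.indicator_of_notMem (fun h => hz h.2) _
      · rw [Set.indicator_of_notMem hy]
        simp [F, hy]
    simp only [hR] at hM
    rw [lintegral_indicator_const measurableSet_Ioo, eq_comm, mul_eq_zero] at hM
    exact hM.resolve_right (rateMeasure_Ioo_ne_zero hcont hpos hB0)

/-- The extra length R is absorbed by shifting the service times by n with Q_n ≥ R: the left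
endpoint for k + n in the shifted sequence is Q_{-k} - Q_n. The n surplus customers are paid for by
the slack c + n. -/
lemma ae_forall_eventually_pointCount_lt (hcont : Continuous rate) (hpos : ∀ x, 0 < rate x)
    (hP : IsPoissonProcess (rateMeasure rate) P) (hT : IsServiceProcess T)
    (hload : NoOverload rate (P.prod T)) :
    ∀ᵐ η ∂T, ∀ᵐ z ∂P, ∀ (R : ℝ) (c : ℕ), ∀ᶠ k : ℕ in atTop,
      pointCount (Set.Ioo (cumService η (-k) - R) 0) z + c < k := by
  have h1 := ae_eventually_pointCount_lt hcont hpos hP hT hload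
  have h2 : ∀ᵐ η ∂T, ∀ n : ℕ, ∀ᵐ z ∂P, ∀ᶠ k : ℕ in atTop,
      pointCount (Set.Ioo (cumService (shiftBy n η) (-k)) 0) z < k :=
    ae_all_iff.2 fun n => (hT.measurePreserving_shiftBy n).quasiMeasurePreserving.ae h1
  filter_upwards [h2, hT.pos, hT.ae_exists_le_cumService] with η hη hη0 hS
  have h3 : ∀ᵐ z ∂P, ∀ n c : ℕ, ∀ᶠ k : ℕ in atTop,
      pointCount (Set.Ioo (cumService (shiftBy n η) (-k)) 0) z + c < k :=
    ae_all_iff.2 fun n => ae_all_iff.2 fun c =>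
      ae_eventually_pointCount_add_lt hcont hpos hP (fun i => hη0 _) (hη n) c
  filter_upwards [h3, hP.isProper] with z hz hzp R c
  obtain ⟨n, hn⟩ := hS R
  filter_upwards [(tendsto_add_atTop_nat n).eventually (hz n (c + n))] with k hk
  have hle : pointCount (Set.Ioo (cumService η (-k) - R) 0) z ≤
      pointCount (Set.Ioo (cumService (shiftBy n η) (-((k + n : ℕ) : ℤ))) 0) z := by
    refine Set.ncard_le_ncard (fun i hi => ?_) (hzp.finite (Metric.isBounded_Ioo _ _))
    refine ⟨lt_of_le_of_lt ?_ hi.1, hi.2⟩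
    rw [cumService_shiftBy, show -((k + n : ℕ) : ℤ) + n = -k by push_cast; ring]
    linarith
  lia

lemma ae_tendsto_excess (hcont : Continuous rate) (hpos : ∀ x, 0 < rate x)
    (hP : IsPoissonProcess (rateMeasure rate) P) (hT : IsServiceProcess T)
    (hload : NoOverload rate (P.prod T)) :
    ∀ᵐ η ∂T, ∀ᵐ z ∂P, Tendsto (excess (z, η)) atBot atBot := by
  filter_upwards [ae_forall_eventually_pointCount_lt hcont hpos hP hT hload] with η hη
  filter_upwards [hη, hP.config, hP.isProper] with z hz hc hzp
  refine tendsto_atBot.2 fun b => ?_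
  -- The slack 1 is needed because z_{-1} may be 0: only customers -k, …, -2 are sure to arrive
  -- before 0, which gives k - 1 points.
  have hev := (hz (-b) 1)
  rw [eventually_atTop] at hev
  obtain ⟨N, hN⟩ := hev
  filter_upwards [eventually_le_atBot (-(N : ℤ)), eventually_le_atBot (-1)] with i hi hi1
  obtain ⟨k, rfl⟩ : ∃ k : ℕ, i = -(k : ℤ) := ⟨(-i).toNat, by lia⟩
  have hk := hN k (by lia)
  by_contra hcon
  push Not at hcon
  simp only [excess] at hcon
  have hsub : ((Finset.Ico (-(k : ℤ)) (-1) : Finset ℤ) : Set ℤ) ⊆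
      {i | z i ∈ Set.Ioo (cumService η (-k) - -b) 0} := by
    intro i hi
    rw [Finset.coe_Ico] at hi
    have h1 := hc.1.monotone hi.1
    have h2 := hc.1 hi.2
    exact ⟨by linarith, by linarith [hc.2.2.2.1]⟩
  have := Set.ncard_le_ncard hsub (hzp.finite (Metric.isBounded_Ioo _ _))
  rw [Set.ncard_coe_finset, Int.card_Ico] at this
  unfold pointCount at hk
  lia

/-- From any moment `s` backwards, the number of arrivals eventually stays below the number of
customers served. -/
lemma ae_forall_eventually_pointCount_Ioo_lt (hcont : Continuous rate) (hpos : ∀ x, 0 < rate x)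
    (hP : IsPoissonProcess (rateMeasure rate) P) (hT : IsServiceProcess T)
    (hload : NoOverload rate (P.prod T)) :
    ∀ᵐ η ∂T, ∀ᵐ z ∂P, ∀ s : ℝ, ∀ᶠ k : ℕ in atTop,
      pointCount (Set.Ioo (s + cumService η (-k)) s) z < k := by
  filter_upwards [ae_forall_eventually_pointCount_lt hcont hpos hP hT hload] with η hη
  filter_upwards [hη, hP.isProper] with z hz hzp s
  -- The slack pays for the arrivals between 0 and s.
  filter_upwards [hz (-s) (pointCount (Set.Ico 0 s) z)] with k hk
  refine lt_of_le_of_lt ?_ hk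
  refine le_trans (Set.ncard_le_ncard (t := {i | z i ∈ Set.Ioo (cumService η (-k) - -s) 0} ∪
    {i | z i ∈ Set.Ico 0 s}) ?_ ((hzp.finite (Metric.isBounded_Ioo _ _)).union
      (hzp.finite (Metric.isBounded_Ico _ _)))) (Set.ncard_union_le _ _)
  intro i hi
  rcases lt_or_ge (z i) 0 with h | h
  · exact Or.inl ⟨by linarith [hi.1], h⟩
  · exact Or.inr ⟨h, hi.2⟩

/-! ### Counts between random endpoints -/

/-- The intervals with rational endpoints. -/
def ratIoo (q : ℚ × ℚ) : Set ℝ := Set.Ioo (q.1 : ℝ) q.2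

lemma measurableSet_ratIoo (q : ℚ × ℚ) : MeasurableSet (ratIoo q) := measurableSet_Ioo

lemma isBounded_ratIoo (q : ℚ × ℚ) : Bornology.IsBounded (ratIoo q) := Metric.isBounded_Ioo _ _

/-- The counts `C` over rational intervals show at least `k` points between `a` and `b`. -/
def AtLeast (C : ℚ × ℚ → ℕ) (a b : ℝ) (k : ℕ) : Prop :=
  ∃ q : ℚ × ℚ, a < q.1 ∧ (q.2 : ℝ) < b ∧ k ≤ C q

/-- Mecke's formula takes counts over a fixed family of sets, but the intervals needed start or end
at the arrival moment itself. The finitely many points of an open interval already lie in a rational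
interval strictly inside it, so rational counts suffice. -/
lemma IsProper.atLeast_iff {z : ℤ → ℝ} (hz : IsProper z) (L : Set ℤ) {a b : ℝ} {k : ℕ}
    (hk : 1 ≤ k) :
    AtLeast (fun q => countOn L z (ratIoo q)) a b k ↔ k ≤ countOn L z (Set.Ioo a b) := by
  constructor
  · rintro ⟨q, h1, h2, h3⟩
    refine h3.trans (Set.ncard_le_ncard (fun i hi => ⟨hi.1, ?_⟩)
      (hz.finite_on (Metric.isBounded_Ioo _ _) _))
    exact ⟨h1.trans hi.2.1, hi.2.2.trans h2⟩
  · intro h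
    have hfin := hz.finite_on (Metric.isBounded_Ioo a b) L
    have hne : hfin.toFinset.Nonempty := by
      rw [Set.Finite.toFinset_nonempty]
      exact Set.nonempty_of_ncard_ne_zero (by unfold countOn at h; lia)
    obtain ⟨i, hi, hmin⟩ := hfin.toFinset.exists_min_image z hne
    obtain ⟨j, hj, hmax⟩ := hfin.toFinset.exists_max_image z hne
    rw [Set.Finite.mem_toFinset] at hi hj
    obtain ⟨q, hq1, hq2⟩ := exists_rat_btwn hi.2.1
    obtain ⟨r, hr1, hr2⟩ := exists_rat_btwn hj.2.2
    refine ⟨(q, r), hq1, hr2, h.trans (Set.ncard_le_ncard (fun l hl => ⟨hl.1, ?_⟩)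
      (hz.finite_on (isBounded_ratIoo _) _))⟩
    have hl' := hfin.mem_toFinset.2 hl
    exact ⟨hq2.trans_le (hmin l hl'), (hmax l hl').trans_lt hr1⟩

lemma IsProper.le_countOn_right_iff {z : ℤ → ℝ} (hz : IsProper z) {i : ℤ} {b : ℝ} {k : ℕ}
    (hk : 1 ≤ k) : k ≤ countOn {i}ᶜ z (Set.Ioo (z i) b) ↔ z (k + i) < b := by
  constructor
  · intro h
    by_contra! hb
    have hsub : {l | l ∈ ({i}ᶜ : Set ℤ) ∧ z l ∈ Set.Ioo (z i) b} ⊆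
        (Finset.Ioo i (k + i) : Finset ℤ) := by
      intro l hl
      rw [Finset.coe_Ioo]
      exact ⟨hz.1.lt_iff_lt.1 hl.2.1, hz.1.lt_iff_lt.1 (hl.2.2.trans_le hb)⟩
    have := Set.ncard_le_ncard hsub
    rw [Set.ncard_coe_finset, Int.card_Ioo] at this
    unfold countOn at h
    lia
  · intro h
    have hsub : ((Finset.Ioc i (k + i) : Finset ℤ) : Set ℤ) ⊆
        {l | l ∈ ({i}ᶜ : Set ℤ) ∧ z l ∈ Set.Ioo (z i) b} := by
      intro l hl
      rw [Finset.coe_Ioc] at hl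
      exact ⟨hl.1.ne', hz.1 hl.1, (hz.1.monotone hl.2).trans_lt h⟩
    have := Set.ncard_le_ncard hsub (hz.finite_on (Metric.isBounded_Ioo _ _) _)
    rw [Set.ncard_coe_finset, Int.card_Ioc] at this
    unfold countOn
    lia

lemma IsProper.le_countOn_left_iff {z : ℤ → ℝ} (hz : IsProper z) {i : ℤ} {a : ℝ} {k : ℕ}
    (hk : 1 ≤ k) : k ≤ countOn {i}ᶜ z (Set.Ioo a (z i)) ↔ a < z (-k + i) := by
  constructor
  · intro h
    by_contra! hb
    have hsub : {l | l ∈ ({i}ᶜ : Set ℤ) ∧ z l ∈ Set.Ioo a (z i)} ⊆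
        (Finset.Ioo (-k + i) i : Finset ℤ) := by
      intro l hl
      rw [Finset.coe_Ioo]
      exact ⟨hz.1.lt_iff_lt.1 (hb.trans_lt hl.2.1), hz.1.lt_iff_lt.1 hl.2.2⟩
    have := Set.ncard_le_ncard hsub
    rw [Set.ncard_coe_finset, Int.card_Ioo] at this
    unfold countOn at h
    lia
  · intro h
    have hsub : ((Finset.Ico (-k + i) i : Finset ℤ) : Set ℤ) ⊆
        {l | l ∈ ({i}ᶜ : Set ℤ) ∧ z l ∈ Set.Ioo a (z i)} := by
      intro l hl
      rw [Finset.coe_Ico] at hl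
      exact ⟨hl.2.ne, h.trans_le (hz.1.monotone hl.1), hz.1 hl.2⟩
    have := Set.ncard_le_ncard hsub (hz.finite_on (Metric.isBounded_Ioo _ _) _)
    rw [Set.ncard_coe_finset, Int.card_Ico] at this
    unfold countOn
    lia

/-! ### The service of the `n`-th follower of a head -/

/-- The customer with index `0` finds the server idle, and the next `n` customers do not. -/
def headSet (n : ℕ) : Set Config :=
  {ω | (∀ k : ℕ, 1 ≤ k → ω.1 (-k) ≤ ω.1 0 + cumService ω.2 (-k)) ∧
    ∀ k : ℕ, 1 ≤ k → k ≤ n → ω.1 k < ω.1 0 + cumService ω.2 k}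

/-- If the busy period starts at `y`, its `n`-th follower is in service at `x`. -/
def startSet (x : ℝ) (n : ℕ) (η : ℤ → ℝ) : Set ℝ :=
  {y | y + cumService η n < x ∧ x < y + cumService η (n + 1)}

open Classical in
/-- The contribution to `V` of the `n`-th follower of the customer with index `0`. -/
def followerTerm (rate : ℝ → ℝ) (x : ℝ) (n : ℕ) (ω : Config) : ENNReal :=
  if ω ∈ headSet n ∧ ω.1 0 ∈ startSet x n ω.2 then ENNReal.ofReal (1 / (rate (ω.1 0) * ω.2 n))
  else 0

@[fun_prop]
lemma measurable_cumService (i : ℤ) : Measurable fun η => cumService η i := by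
  unfold cumService
  fun_prop

lemma measurableSet_headSet (n : ℕ) : MeasurableSet (headSet n) := by
  have h1 (k : ℕ) : MeasurableSet {ω : Config | ω.1 (-k) ≤ ω.1 0 + cumService ω.2 (-k)} :=
    measurableSet_le (by fun_prop) (by fun_prop)
  have h2 (k : ℕ) : MeasurableSet {ω : Config | ω.1 k < ω.1 0 + cumService ω.2 k} :=
    measurableSet_lt (by fun_prop) (by fun_prop)
  have : headSet n = (⋂ k : ℕ, ⋂ _ : 1 ≤ k, {ω : Config | ω.1 (-k) ≤ ω.1 0 + cumService ω.2 (-k)}) ∩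
      ⋂ k : ℕ, ⋂ _ : 1 ≤ k, ⋂ _ : k ≤ n, {ω : Config | ω.1 k < ω.1 0 + cumService ω.2 k} := by
    ext ω
    simp [headSet]
  rw [this]
  exact (MeasurableSet.iInter fun k => MeasurableSet.iInter fun _ => h1 k).inter
    (MeasurableSet.iInter fun k => MeasurableSet.iInter fun _ => MeasurableSet.iInter fun _ => h2 k)

lemma measurableSet_startSet (x : ℝ) (n : ℕ) (η : ℤ → ℝ) : MeasurableSet (startSet x n η) :=
  (measurableSet_lt (f := fun y => y + cumService η n) (g := fun _ => x)
    (by fun_prop) (by fun_prop)).inter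
    (measurableSet_lt (f := fun _ => x) (g := fun y => y + cumService η (n + 1))
      (by fun_prop) (by fun_prop))

lemma measurable_followerTerm {rate : ℝ → ℝ} (hcont : Continuous rate) (x : ℝ) (n : ℕ) :
    Measurable (followerTerm rate x n) := by
  have h1 : MeasurableSet {ω : Config | ω.1 0 + cumService ω.2 n < x} :=
    measurableSet_lt (by fun_prop) (by fun_prop)
  have h2 : MeasurableSet {ω : Config | x < ω.1 0 + cumService ω.2 (n + 1)} :=
    measurableSet_lt (by fun_prop) (by fun_prop)
  refine Measurable.ite ((measurableSet_headSet n).inter (h1.inter h2)) ?_ measurable_const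
  have : Measurable rate := hcont.measurable
  fun_prop

lemma shift_mem_headSet_iff {ω : Config} (i : ℤ) (n : ℕ) :
    (shiftBy i ω.1, shiftBy i ω.2) ∈ headSet n ↔
      FindsIdle ω i ∧ ∀ k, i < k → k ≤ i + n → excess ω k < excess ω i := by
  have e (k : ℤ) : cumService (shiftBy i ω.2) k = cumService ω.2 (k + i) - cumService ω.2 i :=
    cumService_shiftBy _ _ _
  constructor
  · rintro ⟨h1, h2⟩
    simp only [e] at h1 h2
    simp only [shiftBy, zero_add] at h1 h2
    refine ⟨fun l hl => ?_, fun k hk hkn => ?_⟩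
    · have := h1 (i - l).toNat (by lia)
      rw [show -(((i - l).toNat : ℕ) : ℤ) + i = l by lia] at this
      simp only [excess]
      linarith
    · have := h2 (k - i).toNat (by lia) (by lia)
      rw [show (((k - i).toNat : ℕ) : ℤ) + i = k by lia] at this
      simp only [excess]
      linarith
  · rintro ⟨h1, h2⟩
    refine ⟨fun k hk => ?_, fun k hk hkn => ?_⟩
    · have := h1 (-k + i) (by lia)
      simp only [e]
      simp only [shiftBy, zero_add]
      simp only [excess] at this
      linarith
    · have := h2 (k + i) (by lia) (by lia)
      simp only [e]
      simp only [shiftBy, zero_add]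
      simp only [excess] at this
      linarith

lemma Recurrent.inServiceAt_iff_shift {ω : Config} (hω : Recurrent ω) (x : ℝ) (i : ℤ) (n : ℕ) :
    InServiceAt ω x i (i + n) ↔ (shiftBy i ω.1, shiftBy i ω.2) ∈ headSet n ∧
      shiftBy i ω.1 0 ∈ startSet x n (shiftBy i ω.2) := by
  rw [hω.inServiceAt_iff, shift_mem_headSet_iff, and_assoc]
  refine and_congr_right fun _ => ?_
  have h1 : i ≤ i + n := by lia
  simp only [h1, true_and]
  refine and_congr_right fun _ => ?_
  simp only [startSet, Set.mem_ofPred_eq, cumService_shiftBy]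
  simp only [shiftBy, zero_add, excess]
  rw [add_comm i (n : ℤ), show (n : ℤ) + 1 + i = n + i + 1 by ring, sub_add_eq_add_sub,
    sub_add_eq_add_sub, add_sub_assoc, add_sub_assoc]

/-- At most one pair contributes, by `inServiceAt_unique`, so the sum does not depend on the choice
made in `V`. -/
lemma Recurrent.V_eq {rate : ℝ → ℝ} (hpos : ∀ x, 0 < rate x) {ω : Config} (hω : Recurrent ω)
    (x : ℝ) : V rate x ω = (∑' p : ℤ × ℕ,
      followerTerm rate x p.2 (shiftBy p.1 ω.1, shiftBy p.1 ω.2)).toReal := by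
  classical
  have hterm (p : ℤ × ℕ) : followerTerm rate x p.2 (shiftBy p.1 ω.1, shiftBy p.1 ω.2) =
      if InServiceAt ω x p.1 (p.1 + p.2) then
        ENNReal.ofReal (1 / (rate (ω.1 p.1) * ω.2 (p.1 + p.2))) else 0 := by
    unfold followerTerm
    refine if_congr (hω.inServiceAt_iff_shift x p.1 p.2).symm ?_ rfl
    simp [shiftBy, add_comm]
  simp only [hterm]
  unfold V
  split_ifs with h
  · have hs := h.choose_spec
    set i := h.choose.1
    set j := h.choose.2
    have hij : i + ((j - i).toNat : ℕ) = j := by have := hs.2.1; lia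
    rw [tsum_eq_single (i, (j - i).toNat)]
    · simp only [hij, hs, if_true]
      rw [ENNReal.toReal_ofReal]
      exact div_nonneg zero_le_one (mul_pos (hpos _) (hω.1 _)).le
    · rintro ⟨i', n⟩ hne
      refine if_neg fun hc => hne ?_
      obtain ⟨h1, h2⟩ := hω.inServiceAt_unique hc hs
      simp only at h1 h2
      rw [Prod.mk.injEq]
      exact ⟨h1, by lia⟩
  · have : ∀ p : ℤ × ℕ, ¬ InServiceAt ω x p.1 (p.1 + p.2) := fun p hp => h ⟨(_, _), hp⟩
    simp [this]

/-! ### The last maximum of a walk -/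

lemma exists_last_max {M : ℕ → ℤ} (h : ∀ᶠ k in atTop, M k < M 0) :
    ∃ n, (∀ l, n < l → M l < M n) ∧ ∀ l, l < n → M l ≤ M n := by
  obtain ⟨K, hK⟩ := eventually_atTop.1 h
  -- The lexicographic order breaks ties in favour of the larger index, which selects the last
  -- maximum.
  obtain ⟨n, hn, hmax⟩ := (Finset.range (K + 1)).exists_max_image
    (fun k => toLex (M k, k)) ⟨0, by simp⟩
  simp only [Prod.Lex.toLex_le_toLex, Finset.mem_range] at hn hmax
  have h0 := hmax 0 (by lia)
  refine ⟨n, fun l hl => ?_, fun l hl => ?_⟩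
  · by_cases hlK : l < K + 1
    · have := hmax l hlK
      lia
    · have := hK l (by lia)
      lia
  · have := hmax l (by lia)
    lia

lemma last_max_unique {M : ℕ → ℤ} {n n' : ℕ} (h : (∀ l, n < l → M l < M n) ∧ ∀ l, l < n → M l ≤ M n)
    (h' : (∀ l, n' < l → M l < M n') ∧ ∀ l, l < n' → M l ≤ M n') : n = n' := by
  rcases lt_trichotomy n n' with hl | hl | hl
  · exact absurd (h.1 n' hl) (h'.2 n hl).not_gt
  · exact hl
  · exact absurd (h'.1 n hl) (h.2 n' hl).not_gt

/-! ### The probability that a busy period lasts -/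

/-- A customer arriving at `y` finds the server idle and the next `n` customers do not, when
`C` counts the other customers over rational intervals. -/
def BusyFrom (n : ℕ) (η : ℤ → ℝ) (y : ℝ) (C : ℚ × ℚ → ℕ) : Prop :=
  (∀ k : ℕ, 1 ≤ k → ¬ AtLeast C (y + cumService η (-k)) y k) ∧
    ∀ k : ℕ, 1 ≤ k → k ≤ n → AtLeast C y (y + cumService η k) k

/-- The counts of points of `z` over rational intervals. -/
def ratCounts (z : ℤ → ℝ) (q : ℚ × ℚ) : ℕ := pointCount (ratIoo q) z

lemma measurable_ratCounts : Measurable ratCounts := by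
  have := measurable_counts Set.univ measurableSet_ratIoo
  simp only [countOn_univ] at this
  exact this

lemma measurableSet_atLeast {f g : ℝ → ℝ} (hf : Measurable f) (hg : Measurable g) (k : ℕ) :
    MeasurableSet {p : ℝ × (ℚ × ℚ → ℕ) | AtLeast p.2 (f p.1) (g p.1) k} := by
  have : {p : ℝ × (ℚ × ℚ → ℕ) | AtLeast p.2 (f p.1) (g p.1) k} =
      ⋃ q : ℚ × ℚ, {p | f p.1 < q.1} ∩ ({p | (q.2 : ℝ) < g p.1} ∩ {p | k ≤ p.2 q}) := by
    ext p
    simp [AtLeast]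
  rw [this]
  refine MeasurableSet.iUnion fun q => (measurableSet_lt (by fun_prop) (by fun_prop)).inter
    ((measurableSet_lt (by fun_prop) (by fun_prop)).inter
      (measurableSet_le measurable_const (by fun_prop)))

lemma measurableSet_busyFrom (n : ℕ) (η : ℤ → ℝ) :
    MeasurableSet {p : ℝ × (ℚ × ℚ → ℕ) | BusyFrom n η p.1 p.2} := by
  have : {p : ℝ × (ℚ × ℚ → ℕ) | BusyFrom n η p.1 p.2} =
      (⋂ k : ℕ, ⋂ _ : 1 ≤ k, {p | AtLeast p.2 (p.1 + cumService η (-k)) p.1 k}ᶜ) ∩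
      ⋂ k : ℕ, ⋂ _ : 1 ≤ k, ⋂ _ : k ≤ n, {p | AtLeast p.2 p.1 (p.1 + cumService η k) k} := by
    ext p
    simp [BusyFrom]
  rw [this]
  refine (MeasurableSet.iInter fun k => MeasurableSet.iInter fun _ => MeasurableSet.compl ?_).inter
    (MeasurableSet.iInter fun k => MeasurableSet.iInter fun _ => MeasurableSet.iInter fun _ => ?_)
  · exact measurableSet_atLeast (f := fun y => y + cumService η (-k)) (g := fun y => y)
      (by fun_prop) measurable_id k
  · exact measurableSet_atLeast (f := fun y => y) (g := fun y => y + cumService η k)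
      measurable_id (by fun_prop) k

lemma IsProper.busyFrom_iff {z : ℤ → ℝ} (hz : IsProper z) (i : ℤ) (n : ℕ) (η : ℤ → ℝ) :
    BusyFrom n η (z i) (fun q => countOn {i}ᶜ z (ratIoo q)) ↔ (shiftBy i z, η) ∈ headSet n := by
  refine and_congr (forall_congr' fun k => forall_congr' fun hk => ?_)
    (forall_congr' fun k => forall_congr' fun hk => forall_congr' fun _ => ?_)
  · rw [hz.atLeast_iff _ hk, hz.le_countOn_left_iff hk, not_lt]
    simp [shiftBy]
  · rw [hz.atLeast_iff _ hk, hz.le_countOn_right_iff hk]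
    simp [shiftBy]

/-- The probability that a customer arriving at `y` finds the server idle and that the next `n`
customers do not. -/
def busyProb (P : Measure (ℤ → ℝ)) (n : ℕ) (η : ℤ → ℝ) (y : ℝ) : ENNReal :=
  P {z | BusyFrom n η y (ratCounts z)}

lemma measurable_busyProb [SFinite P] (n : ℕ) (η : ℤ → ℝ) : Measurable (busyProb P n η) := by
  have : MeasurableSet {p : ℝ × (ℤ → ℝ) | BusyFrom n η p.1 (ratCounts p.2)} :=
    (measurable_fst.prodMk (measurable_ratCounts.comp measurable_snd)) (measurableSet_busyFrom n η)
  exact measurable_measure_prodMk_left this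

/-- Mecke's formula with the head as distinguished point; its intensity `rate y` cancels the weight
`1 / rate y`, leaving Lebesgue measure. -/
lemma tsum_lintegral_followerTerm (hcont : Continuous rate) (hpos : ∀ x, 0 < rate x)
    (hP : IsPoissonProcess (rateMeasure rate) P) (x : ℝ) (n : ℕ) (η : ℤ → ℝ) :
    ∑' i : ℤ, ∫⁻ z, followerTerm rate x n (shiftBy i z, η) ∂P =
      ∫⁻ y, (startSet x n η).indicator 1 y * ENNReal.ofReal (1 / η n) * busyProb P n η y := by
  classical
  have := hP.isProbabilityMeasure
  have hrate : Measurable rate := hcont.measurable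
  let a : ℝ → ENNReal := fun y =>
    (startSet x n η).indicator (fun y => ENNReal.ofReal (1 / (rate y * η n))) y
  have ha : Measurable a := Measurable.indicator (by fun_prop) (measurableSet_startSet x n η)
  let F : ℝ × (ℚ × ℚ → ℕ) → ENNReal := fun p =>
    a p.1 * {p : ℝ × (ℚ × ℚ → ℕ) | BusyFrom n η p.1 p.2}.indicator 1 p
  have hF : Measurable F :=
    (ha.comp measurable_fst).mul (measurable_one.indicator (measurableSet_busyFrom n η))
  have h1 (i : ℤ) : ∫⁻ z, followerTerm rate x n (shiftBy i z, η) ∂P =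
      ∫⁻ z, F (z i, fun q => countOn {i}ᶜ z (ratIoo q)) ∂P := by
    refine lintegral_congr_ae ?_
    filter_upwards [hP.isProper] with z hz
    have e : shiftBy i z 0 = z i := by simp [shiftBy]
    simp only [followerTerm, F, a, e]
    by_cases hb : (shiftBy i z, η) ∈ headSet n
    · rw [Set.indicator_of_mem (s := {p : ℝ × (ℚ × ℚ → ℕ) | BusyFrom n η p.1 p.2})
        ((hz.busyFrom_iff i n η).2 hb)]
      by_cases hs : z i ∈ startSet x n η <;> simp [hb, hs]
    · rw [Set.indicator_of_notMem (s := {p : ℝ × (ℚ × ℚ → ℕ) | BusyFrom n η p.1 p.2})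
        (fun h => hb ((hz.busyFrom_iff i n η).1 h))]
      simp [hb]
  have h2 (y : ℝ) : ∫⁻ z, F (y, fun q => pointCount (ratIoo q) z) ∂P = a y * busyProb P n η y := by
    have hm : MeasurableSet {z : ℤ → ℝ | BusyFrom n η y (ratCounts z)} :=
      (measurable_const.prodMk measurable_ratCounts) (measurableSet_busyFrom n η)
    rw [busyProb, ← lintegral_indicator_one hm,
      ← lintegral_const_mul _ (measurable_one.indicator hm)]
    rfl
  simp only [h1]
  rw [hP.mecke (fun B hB => rateMeasure_ne_top hcont hB) measurableSet_ratIoo isBounded_ratIoo hF]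
  simp only [h2]
  rw [rateMeasure, lintegral_withDensity_eq_lintegral_mul _ (by fun_prop)
    (g := fun y => a y * busyProb P n η y) (ha.mul (measurable_busyProb n η))]
  refine lintegral_congr fun y => ?_
  simp only [Pi.mul_apply]
  rw [← mul_assoc]
  congr 1
  by_cases hs : y ∈ startSet x n η
  · simp only [a, Set.indicator_of_mem hs, Pi.one_apply, one_mul]
    rw [← ENNReal.ofReal_mul (hpos y).le]
    congr 1
    have := (hpos y).ne'
    field_simp
  · simp [a, hs]

/-- Up to a null set the events partition the space according to the last maximum n of M_k = N_k -
k, with N_k the count on (s + Q_{-k}, s). Finding the server idle means M_l < M_n for l > n; the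
waiting of the next n customers means M_l ≤ M_n for l < n. -/
lemma tsum_busyProb (hP : IsPoissonProcess (rateMeasure rate) P) {η : ℤ → ℝ} (hη : ∀ i, 0 < η i)
    (h : ∀ᵐ z ∂P, ∀ s : ℝ, ∀ᶠ k : ℕ in atTop,
      pointCount (Set.Ioo (s + cumService η (-k)) s) z < k) (s : ℝ) :
    ∑' n : ℕ, busyProb P n (shiftBy (-n) η) (s + cumService η (-n)) = 1 := by
  classical
  have := hP.isProbabilityMeasure
  have hQ := cumService_strictMono hη
  -- No arrival falls on an endpoint, so the counts over adjacent open intervals add up.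
  have hnull : ∀ᵐ z ∂P, ∀ k : ℕ, pointCount {s + cumService η (-k)} z = 0 := by
    refine ae_all_iff.2 fun k => ?_
    have h1 := hP.map_pointCount {s + cumService η (-k)} (measurableSet_singleton _)
      Bornology.isBounded_singleton
    rw [rateMeasure_singleton] at h1
    have h2 : ∀ᵐ j ∂P.map (pointCount {s + cumService η (-k)}), j = 0 := by
      rw [h1, ae_iff]
      have : (poissonMeasure (ENNReal.toNNReal 0)) {0}ᶜ = 0 := by
        rw [prob_compl_eq_zero_iff (measurableSet_singleton _), poissonMeasure_singleton]
        simp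
      exact this
    exact ae_of_ae_map (measurable_pointCount (measurableSet_singleton _)).aemeasurable h2
  let E : ℕ → Set (ℤ → ℝ) := fun n =>
    {z | BusyFrom n (shiftBy (-n) η) (s + cumService η (-n)) (ratCounts z)}
  have hE (n : ℕ) : MeasurableSet (E n) :=
    (measurable_const.prodMk measurable_ratCounts) (measurableSet_busyFrom n _)
  have hsum : ∀ᵐ z ∂P, ∑' n, (E n).indicator (1 : (ℤ → ℝ) → ENNReal) z = 1 := by
    filter_upwards [h, hnull, hP.isProper] with z hz h0 hzp
    let N : ℕ → ℕ := fun k => pointCount (Set.Ioo (s + cumService η (-k)) s) z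
    have hN (a b : ℕ) (hab : a < b) : N b = N a +
        pointCount (Set.Ioo (s + cumService η (-b)) (s + cumService η (-a))) z := by
      have hQab : cumService η (-b) < cumService η (-a) := hQ (by lia)
      have hQa : cumService η (-a) ≤ 0 := by
        rw [← cumService_zero η]
        exact hQ.monotone (by lia)
      have hne (i : ℤ) : z i ≠ s + cumService η (-a) := by
        intro hc
        have hf := hzp.finite (Bornology.isBounded_singleton (x := s + cumService η (-a)))
        have := (Set.ncard_eq_zero hf).1 (h0 a)
        exact (this ▸ Set.notMem_empty i) hc
      have hu : {i | z i ∈ Set.Ioo (s + cumService η (-b)) s} =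
          {i | z i ∈ Set.Ioo (s + cumService η (-a)) s} ∪
          {i | z i ∈ Set.Ioo (s + cumService η (-b)) (s + cumService η (-a))} := by
        ext i
        simp only [Set.mem_union, Set.mem_ofPred_eq, Set.mem_Ioo]
        constructor
        · rintro ⟨h1, h2⟩
          rcases lt_or_gt_of_ne (hne i) with h3 | h3
          · exact Or.inr ⟨h1, h3⟩
          · exact Or.inl ⟨h3, h2⟩
        · rintro (⟨h1, h2⟩ | ⟨h1, h2⟩)
          · exact ⟨by linarith, h2⟩
          · exact ⟨h1, by linarith⟩
      change Set.ncard _ = _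
      rw [hu, Set.ncard_union_eq _ (hzp.finite (Metric.isBounded_Ioo _ _))
        (hzp.finite (Metric.isBounded_Ioo _ _))]
      · rfl
      · exact Set.disjoint_left.2 fun i h1 h2 => lt_asymm h1.1 h2.2
    let M : ℕ → ℤ := fun k => N k - k
    have hM0 : M 0 = 0 := by
      simp only [M, N, Nat.cast_zero, neg_zero, cumService_zero, add_zero, Set.Ioo_self,
        pointCount, Set.mem_empty_iff_false, sub_zero]
      simp
    have hMn (n : ℕ) : z ∈ E n ↔ (∀ l, n < l → M l < M n) ∧ ∀ l, l < n → M l ≤ M n := by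
      have hal (a b : ℝ) (k : ℕ) (hk : 1 ≤ k) :
          AtLeast (ratCounts z) a b k ↔ k ≤ pointCount (Set.Ioo a b) z := by
        have := hzp.atLeast_iff Set.univ (a := a) (b := b) hk
        simp only [countOn_univ] at this
        exact this
      change BusyFrom _ _ _ _ ↔ _
      unfold BusyFrom
      simp only [cumService_shiftBy, add_add_sub_cancel]
      refine and_congr ⟨fun H l hl => ?_, fun H k hk => ?_⟩ ⟨fun H l hl => ?_, fun H k hk hkn => ?_⟩
      · have h1 := H (l - n) (by lia)
        rw [hal _ _ _ (by lia), show -((l - n : ℕ) : ℤ) + -(n : ℤ) = -l by lia] at h1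
        have := hN n l hl
        simp only [M]
        lia
      · have h1 := H (n + k) (by lia)
        rw [hal _ _ _ hk, show -(k : ℤ) + -(n : ℤ) = -(n + k : ℕ) by lia]
        have := hN n (n + k) (by lia)
        simp only [M] at h1
        lia
      · have h1 := H (n - l) (by lia) (by lia)
        rw [hal _ _ _ (by lia), show ((n - l : ℕ) : ℤ) + -(n : ℤ) = -l by lia] at h1
        have := hN l n hl
        simp only [M]
        lia
      · have h1 := H (n - k) (by lia)
        rw [hal _ _ _ hk, show (k : ℤ) + -(n : ℤ) = -(n - k : ℕ) by lia]
        have := hN (n - k) n (by lia)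
        simp only [M] at h1
        lia
    obtain ⟨n, hn⟩ := exists_last_max (M := M) (by
      filter_upwards [hz s] with k hk
      rw [hM0]
      simp only [M, N]
      lia)
    rw [tsum_eq_single n fun n' hn' => Set.indicator_of_notMem
      (fun hc => hn' (last_max_unique ((hMn n').1 hc) hn)) _]
    exact Set.indicator_of_mem ((hMn n).2 hn) _
  calc ∑' n : ℕ, busyProb P n (shiftBy (-n) η) (s + cumService η (-n))
      = ∑' n, ∫⁻ z, (E n).indicator 1 z ∂P :=
        tsum_congr fun n => (lintegral_indicator_one (hE n)).symm
    _ = ∫⁻ z, ∑' n, (E n).indicator 1 z ∂P :=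
        (lintegral_tsum fun n => (measurable_one.indicator (hE n)).aemeasurable).symm
    _ = 1 := by rw [lintegral_congr_ae hsum]; simp

lemma tsum_tsum_lintegral_followerTerm (hcont : Continuous rate) (hpos : ∀ x, 0 < rate x)
    (hP : IsPoissonProcess (rateMeasure rate) P) {η : ℤ → ℝ} (hη : ∀ i, 0 < η i)
    (h : ∀ᵐ z ∂P, ∀ s : ℝ, ∀ᶠ k : ℕ in atTop,
      pointCount (Set.Ioo (s + cumService η (-k)) s) z < k) (x : ℝ) :
    ∑' n : ℕ, ∑' i : ℤ, ∫⁻ z, followerTerm rate x n (shiftBy i z, shiftBy (-n) η) ∂P = 1 := by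
  have := hP.isProbabilityMeasure
  let c := ENNReal.ofReal (1 / η 0)
  have h1 (n : ℕ) : ∑' i : ℤ, ∫⁻ z, followerTerm rate x n (shiftBy i z, shiftBy (-n) η) ∂P =
      ∫⁻ s, (Set.Ioo (x - η 0) x).indicator 1 s * c *
        busyProb P n (shiftBy (-n) η) (s + cumService η (-n)) := by
    -- The translation y = s + Q_{-n} passes from the arrival of the head to the start s of the
    -- current service, whose range (x - η_0, x) is the same for all n.
    rw [tsum_lintegral_followerTerm hcont hpos hP,
      ← lintegral_add_right_eq_self _ (cumService η (-n))]
    refine lintegral_congr fun s => ?_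
    have e1 : shiftBy (-n) η n = η 0 := by simp [shiftBy]
    have e2 : s + cumService η (-n) ∈ startSet x n (shiftBy (-n) η) ↔
        s ∈ Set.Ioo (x - η 0) x := by
      have e3 := cumService_add_one η 0
      rw [cumService_zero, zero_add, zero_add] at e3
      simp only [startSet, Set.mem_ofPred_eq, cumService_shiftBy, Set.mem_Ioo]
      rw [add_right_comm (n : ℤ) 1, add_neg_cancel, zero_add, e3, cumService_zero]
      constructor
      · rintro ⟨h1, h2⟩
        constructor <;> linarith
      · rintro ⟨h1, h2⟩
        constructor <;> linarith
    rw [e1]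
    congr 2
    by_cases hs : s ∈ Set.Ioo (x - η 0) x
    · rw [Set.indicator_of_mem hs, Set.indicator_of_mem (e2.2 hs)]; rfl
    · rw [Set.indicator_of_notMem hs, Set.indicator_of_notMem (fun h => hs (e2.1 h))]
  have hb (n : ℕ) : Measurable fun s =>
      busyProb P n (shiftBy (-n) η) (s + cumService η (-n)) :=
    (measurable_busyProb n _).comp (measurable_add_const _)
  have hi : Measurable fun s => (Set.Ioo (x - η 0) x).indicator (1 : ℝ → ENNReal) s :=
    measurable_one.indicator measurableSet_Ioo
  simp only [h1]
  rw [← lintegral_tsum (f := fun (n : ℕ) s => (Set.Ioo (x - η 0) x).indicator 1 s * c *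
    busyProb P n (shiftBy (-n) η) (s + cumService η (-n)))
    fun n => ((hi.mul_const c).mul (hb n)).aemeasurable]
  simp only [ENNReal.tsum_mul_left, tsum_busyProb hP hη h, mul_one]
  rw [lintegral_mul_const _ hi, lintegral_indicator_one measurableSet_Ioo, Real.volume_Ioo,
    sub_sub_cancel, ← ENNReal.ofReal_mul (hη 0).le, mul_one_div_cancel (hη 0).ne',
    ENNReal.ofReal_one]

lemma ae_recurrent (hcont : Continuous rate) (hpos : ∀ x, 0 < rate x)
    (hP : IsPoissonProcess (rateMeasure rate) P) (hT : IsServiceProcess T)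
    (hload : NoOverload rate (P.prod T)) : ∀ᵐ ω ∂P.prod T, Recurrent ω := by
  have := hP.isProbabilityMeasure
  have := hT.isProbabilityMeasure
  have hex (i : ℤ) : Measurable fun ω : Config => excess ω i := by unfold excess; fun_prop
  have hmeas : MeasurableSet {ω | Recurrent ω} := by
    have : {ω | Recurrent ω} = (⋂ i : ℤ, {ω : Config | 0 < ω.2 i}) ∩
        ⋂ j : ℤ, ⋃ i : ℤ, ⋃ _ : i < j, ⋂ l : ℤ, ⋂ _ : l < i, {ω | excess ω l ≤ excess ω i} := by
      ext ω
      simp [Recurrent, FindsIdle]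
    rw [this]
    exact (MeasurableSet.iInter fun i => measurableSet_lt (by fun_prop) (by fun_prop)).inter
      (MeasurableSet.iInter fun j => MeasurableSet.iUnion fun i => MeasurableSet.iUnion fun _ =>
        MeasurableSet.iInter fun l => MeasurableSet.iInter fun _ =>
          measurableSet_le (hex l) (hex i))
  -- The exceptional set of arrivals depends on η, so the service times are fixed first.
  have h1 : ∀ᵐ p ∂T.prod P, Recurrent p.swap := by
    refine (Measure.ae_prod_iff_ae_ae (measurable_swap hmeas)).2 ?_
    filter_upwards [ae_tendsto_excess hcont hpos hP hT hload, hT.pos] with η h hη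
    filter_upwards [h] with z hz
    exact recurrent_of_tendsto hη hz
  exact (Measure.measurePreserving_swap (μ := P) (ν := T)).quasiMeasurePreserving.ae h1

lemma lintegral_tsum_followerTerm (hcont : Continuous rate) (hpos : ∀ x, 0 < rate x)
    (hP : IsPoissonProcess (rateMeasure rate) P) (hT : IsServiceProcess T)
    (hload : NoOverload rate (P.prod T)) (x : ℝ) :
    ∫⁻ ω, ∑' p : ℤ × ℕ, followerTerm rate x p.2 (shiftBy p.1 ω.1, shiftBy p.1 ω.2) ∂P.prod T =
      1 := by
  have := hP.isProbabilityMeasure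
  have := hT.isProbabilityMeasure
  have hm (n : ℕ) := measurable_followerTerm hcont x n
  have hs (i : ℤ) := measurable_shiftBy i
  have hmi (i : ℤ) (n : ℕ) : Measurable fun ω : Config =>
      followerTerm rate x n (shiftBy i ω.1, shiftBy i ω.2) :=
    (hm n).comp (((hs i).comp measurable_fst).prodMk ((hs i).comp measurable_snd))
  have hmi' (i : ℤ) (n : ℕ) : Measurable fun ω : Config =>
      followerTerm rate x n (shiftBy i ω.1, ω.2) :=
    (hm n).comp (((hs i).comp measurable_fst).prodMk measurable_snd)
  have hI (i : ℤ) (n : ℕ) : Measurable fun η =>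
      ∫⁻ z, followerTerm rate x n (shiftBy i z, η) ∂P := (hmi' i n).lintegral_prod_left'
  have h1 (i : ℤ) (n : ℕ) :
      ∫⁻ ω, followerTerm rate x n (shiftBy i ω.1, shiftBy i ω.2) ∂P.prod T =
        ∫⁻ η, ∫⁻ z, followerTerm rate x n (shiftBy i z, η) ∂P ∂T := by
    rw [lintegral_prod_symm' _ (hmi i n)]
    exact hT.lintegral_shiftBy i fun η => ∫⁻ z, followerTerm rate x n (shiftBy i z, η) ∂P
  rw [lintegral_tsum (f := fun (p : ℤ × ℕ) (ω : Config) =>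
    followerTerm rate x p.2 (shiftBy p.1 ω.1, shiftBy p.1 ω.2))
    fun p => (hmi p.1 p.2).aemeasurable]
  simp only [h1]
  rw [ENNReal.tsum_prod (f := fun (i : ℤ) (n : ℕ) =>
    ∫⁻ η, ∫⁻ z, followerTerm rate x n (shiftBy i z, η) ∂P ∂T), ENNReal.tsum_comm]
  -- The second use of stationarity: for every n the service time of the customer in service becomes
  -- η_0, so the sum over n can be evaluated for fixed η.
  have h2 (n : ℕ) : ∑' i : ℤ, ∫⁻ η, ∫⁻ z, followerTerm rate x n (shiftBy i z, η) ∂P ∂T =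
      ∫⁻ η, ∑' i : ℤ, ∫⁻ z, followerTerm rate x n (shiftBy i z, shiftBy (-n) η) ∂P ∂T := by
    rw [← lintegral_tsum fun i => (hI i n).aemeasurable]
    exact (hT.lintegral_shiftBy (-n) fun η =>
      ∑' i : ℤ, ∫⁻ z, followerTerm rate x n (shiftBy i z, η) ∂P).symm
  simp only [h2]
  have hmn (n : ℕ) : Measurable fun η =>
      ∑' i : ℤ, ∫⁻ z, followerTerm rate x n (shiftBy i z, shiftBy (-n) η) ∂P :=
    Measurable.tsum fun i => (hI i n).comp (hs (-n))
  rw [← lintegral_tsum fun n : ℕ => (hmn n).aemeasurable]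
  have h3 : ∀ᵐ η ∂T, ∑' n : ℕ, ∑' i : ℤ,
      ∫⁻ z, followerTerm rate x n (shiftBy i z, shiftBy (-n) η) ∂P = 1 := by
    filter_upwards [ae_forall_eventually_pointCount_Ioo_lt hcont hpos hP hT hload, hT.pos]
      with η h hη
    exact tsum_tsum_lintegral_followerTerm hcont hpos hP hη h x
  rw [lintegral_congr_ae h3]
  simp

end QueueFlow

end

theorem mainTheorem3 (rate : ℝ → ℝ) (hcont : Continuous rate) (hpos : ∀ x, 0 < rate x)
    (hleft : ∫⁻ x in Set.Iic (0 : ℝ), ENNReal.ofReal (rate x) = ⊤)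
    (hright : ∫⁻ x in Set.Ici (0 : ℝ), ENNReal.ofReal (rate x) = ⊤)
    (P : Measure (ℤ → ℝ)) (hP : QueueFlow.IsPoissonProcess (QueueFlow.rateMeasure rate) P)
    (T : Measure (ℤ → ℝ)) (hT : QueueFlow.IsServiceProcess T)
    (hload : QueueFlow.NoOverload rate (P.prod T)) (x : ℝ) :
    Integrable (QueueFlow.V rate x) (P.prod T) ∧
      ∫ ω, QueueFlow.V rate x ω ∂(P.prod T) = 1 := by
  let G : QueueFlow.Config → ENNReal := fun ω => ∑' p : ℤ × ℕ,
    QueueFlow.followerTerm rate x p.2 (QueueFlow.shiftBy p.1 ω.1, QueueFlow.shiftBy p.1 ω.2)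
  have hG : Measurable G := Measurable.tsum fun p =>
    (QueueFlow.measurable_followerTerm hcont x p.2).comp
      (((QueueFlow.measurable_shiftBy p.1).comp measurable_fst).prodMk
        ((QueueFlow.measurable_shiftBy p.1).comp measurable_snd))
  have hG1 : ∫⁻ ω, G ω ∂P.prod T = 1 :=
    QueueFlow.lintegral_tsum_followerTerm hcont hpos hP hT hload x
  have hV : QueueFlow.V rate x =ᵐ[P.prod T] fun ω => (G ω).toReal :=
    (QueueFlow.ae_recurrent hcont hpos hP hT hload).mono fun ω hω => hω.V_eq hpos x
  have hne : ∫⁻ ω, G ω ∂P.prod T ≠ ⊤ := by simp [hG1]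
  refine ⟨(integrable_toReal_of_lintegral_ne_top hG.aemeasurable hne).congr hV.symm, ?_⟩
  rw [integral_congr_ae hV, integral_toReal hG.aemeasurable (ae_lt_top hG hne), hG1]
  simp
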